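/- Let $d\ge 1$, let $D\subset\mathbb{R}^d$ be the closure of a nonempty open, bounded, convex set, and let $a,b\in D$. Let $p>1$ and let $f:D\times\mathbb{R}^d\to[0,\infty)$ satisfy: (A0) $f$ is continuous on $D\times\mathbb{R}^d$ and $C^1$ on $D\times(\mathbb{R}^d\setminus\{0\})$; (A1) $v\mapsto f(x,v)$ is convex for every $x\in D$; (A2) $f(x,\lambda v)=\lambda^p f(x,v)$ for all $x\in D$, $v\in\mathbb{R}^d$, $\lambda>0$; (A3) there are constants $m_1,m_2>0$ with $m_1|v|^p\le f(x,v)\le m_2|v|^p$ for all $x\in D$, $v\in\mathbb{R}^d$. Let $\Omega(a,b)$ be the set of Lipschitz paths $\gamma:[0,1]\to D$ with $\gamma(0)=a$, $\gamma(1)=b$, and put $F(\gamma)=\int_0^1 f(\gamma(t),\dot\gamma(t))\,dt$ for $\gamma\in\Omega(a,b)$. Let $X_1,X_2,\dots$ be independent, identically distributed random points of $D$ whose law has a density $\rho$ with respect to Lebesgue measure, such that for some $c>0$, $c\le\rho(x)\le c^{-1}$ for all $x\in D$. Let $\epsilon_n>0$ satisfy $$\lim_{n\to\infty}\epsilon_n=0,\qquad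 \lim_{n\to\infty}\frac{(\log n)^{1/d}}{n^{1/d}}\,\frac1{\epsilon_n}=0 .$$ Let $\mathcal{G}_n$ be the graph with vertex set $\{X_1,\dots,X_n\}\cup\{a,b\}$ in which $u,w$ are joined by an edge iff $0<|u-w|<\epsilon_n$. For a path $\mathbf{v}=(v_0,\dots,v_m)$, $m\ge1$, from $v_0=a$ to $v_m=b$ in $\mathcal{G}_n$, let $l_{\mathbf v}:[0,1]\to D$ be its piecewise linear interpolation $$l_{\mathbf v}(t)=(1-(mt-i))\,v_i+(mt-i)\,v_{i+1},\qquad \tfrac{i}{m}\le t\le\tfrac{i+1}{m},\quad 0\le i<m .$$ Let $\Omega_n^l(a,b)$ be the set of all such $l_{\mathbf v}$, and let $L_n$ be the restriction of $F$ to $\Omega_n^l(a,b)$. Then $F$ attains its minimum on $\Omega(a,b)$, and with probability $1$ the following holds. 1. For all sufficiently large $n$, $L_n$ attains its minimum on $\Omega_n^l(a,b)$, and $$\lim_{n\to\infty}\ \min_{\gamma\in\Omega_n^l(a,b)}L_n(\gamma)=\min_{\gamma\in\Omega(a,b)}F(\gamma).$$ 2. Let $(\gamma_n)$ be any sequence of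 paths with $\gamma_n\in\operatorname{argmin}L_n$ for all sufficiently large $n$. Then every subsequence of $(\gamma_n)$ has a further subsequence $(\gamma_{n_k})$ that converges uniformly to some $\gamma\in\operatorname{argmin}F$, that is, $\lim_{k\to\infty}\sup_{0\le t\le1}|\gamma_{n_k}(t)-\gamma(t)|=0$. 3. If in addition $F$ has a unique minimizer $\gamma$ in $\Omega(a,b)$, then for every sequence as in 2 the whole sequence $(\gamma_n)$ converges uniformly to $\gamma$. -/

import Mathlib

open MeasureTheory ProbabilityTheory Filter Set Topology

noncomputable section

namespace RandomGeodesics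

/-- `D` is the closure of an open, bounded, convex domain. -/
def IsConvexBody {d : ℕ} (D : Set (EuclideanSpace ℝ (Fin d))) : Prop :=
  ∃ U : Set (EuclideanSpace ℝ (Fin d)),
    U.Nonempty ∧ IsOpen U ∧ Bornology.IsBounded U ∧ Convex ℝ U ∧ D = closure U

/-- The standing assumptions on an integrand `f : D × ℝᵈ → [0, ∞)` of homogeneity degree `p`;
only the values `f x v` with `x ∈ D` matter. -/
structure IsKernel {d : ℕ} (D : Set (EuclideanSpace ℝ (Fin d))) (p : ℝ)
    (f : EuclideanSpace ℝ (Fin d) → EuclideanSpace ℝ (Fin d) → ℝ) : Prop where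
  continuousOn : ContinuousOn (fun z : EuclideanSpace ℝ (Fin d) × EuclideanSpace ℝ (Fin d) =>
    f z.1 z.2) (D ×ˢ univ)
  contDiffOn : ContDiffOn ℝ 1 (fun z : EuclideanSpace ℝ (Fin d) × EuclideanSpace ℝ (Fin d) =>
    f z.1 z.2) (D ×ˢ {0}ᶜ)
  convexOn : ∀ x ∈ D, ConvexOn ℝ univ (f x)
  homogeneous : ∀ x ∈ D, ∀ v, ∀ r : ℝ, 0 < r → f x (r • v) = r ^ p * f x v
  elliptic : ∃ m₁ m₂ : ℝ, 0 < m₁ ∧ 0 < m₂ ∧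
    ∀ x ∈ D, ∀ v, m₁ * ‖v‖ ^ p ≤ f x v ∧ f x v ≤ m₂ * ‖v‖ ^ p

/-- `Ω(a,b)`: Lipschitz paths `[0,1] → D` from `a` to `b`. A path is represented by a function
on `ℝ` of which only the restriction to `[0,1]` is relevant. -/
def lipPaths {d : ℕ} (D : Set (EuclideanSpace ℝ (Fin d))) (a b : EuclideanSpace ℝ (Fin d)) :
    Set (ℝ → EuclideanSpace ℝ (Fin d)) :=
  {γ | (∃ K, LipschitzOnWith K γ (Icc 0 1)) ∧ MapsTo γ (Icc 0 1) D ∧ γ 0 = a ∧ γ 1 = b}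

/-- `F(γ) = ∫₀¹ f(γ(t), γ'(t)) dt`. -/
def cost {d : ℕ} (f : EuclideanSpace ℝ (Fin d) → EuclideanSpace ℝ (Fin d) → ℝ)
    (γ : ℝ → EuclideanSpace ℝ (Fin d)) : ℝ :=
  ∫ t in (0 : ℝ)..1, f (γ t) (deriv γ t)

/-- The minimizers of `J` over `S`. -/
def argmin {α : Type*} (J : α → ℝ) (S : Set α) : Set α :=
  {γ | γ ∈ S ∧ ∀ η ∈ S, J γ ≤ J η}

/-- The vertex set `{x₁, …, xₙ} ∪ {a, b}`, the sample points being numbered from `0`. -/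
def vertices {d : ℕ} (x : ℕ → EuclideanSpace ℝ (Fin d)) (n : ℕ)
    (a b : EuclideanSpace ℝ (Fin d)) : Set (EuclideanSpace ℝ (Fin d)) :=
  x '' Iio n ∪ {a, b}

/-- `(v 0, …, v m)` is a path with `m ≥ 1` steps from `a` to `b` in the graph on the vertex set
`V` in which `u`, `w` are adjacent iff `0 < |u - w| < ε`. The values `v i`, `i > m`, are
irrelevant. -/
structure IsGraphPath {d : ℕ} (V : Set (EuclideanSpace ℝ (Fin d))) (ε : ℝ)
    (a b : EuclideanSpace ℝ (Fin d)) (m : ℕ) (v : ℕ → EuclideanSpace ℝ (Fin d)) : Prop where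
  steps_pos : 0 < m
  start : v 0 = a
  finish : v m = b
  mem : ∀ i ≤ m, v i ∈ V
  adj : ∀ i < m, 0 < ‖v i - v (i + 1)‖ ∧ ‖v i - v (i + 1)‖ < ε

/-- On `[0,1]`, `γ` is the concatenation `l_v` of the segments from `v i` to `v (i+1)`,
`0 ≤ i < m`, each traversed at constant speed in time `1/m`. -/
def IsPolyline {d : ℕ} (m : ℕ) (v : ℕ → EuclideanSpace ℝ (Fin d))
    (γ : ℝ → EuclideanSpace ℝ (Fin d)) : Prop :=
  ∀ i < m, ∀ t ∈ Icc ((i : ℝ) / m) (((i : ℝ) + 1) / m),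
    γ t = (1 - ((m : ℝ) * t - i)) • v i + ((m : ℝ) * t - i) • v (i + 1)

/-- `Ωₙˡ(a,b)`: the linear interpolations of the paths from `a` to `b` in the graph on
`{x₁, …, xₙ} ∪ {a, b}` with length scale `ε`. -/
def polyPaths {d : ℕ} (x : ℕ → EuclideanSpace ℝ (Fin d)) (n : ℕ) (ε : ℝ)
    (a b : EuclideanSpace ℝ (Fin d)) : Set (ℝ → EuclideanSpace ℝ (Fin d)) :=
  {γ | ∃ m v, IsGraphPath (vertices x n a b) ε a b m v ∧ IsPolyline m v γ}

end RandomGeodesics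

end

/-! Everything is expressed through the asymmetric distance `gdist`, the `p`-th root of the minimal
cost. By homogeneity, running a path for a time `θ` divides its cost by `θ ^ (p - 1)`; the optimal
split of time between two paths gives the triangle inequality (`gdist_triangle`). Ellipticity and
Jensen make `gdist` comparable with the Euclidean distance, so paths of bounded cost are uniformly
Hölder and Arzelà–Ascoli applies.

Limits are identified without a general lower semicontinuity theorem. Write `l` for the distance
from `a` to `b`. By strict convexity of `u ↦ u ^ p`, a path of cost close to `l ^ p` has nearly
constant `gdist`-speed (`speed_defect_le`), so a uniform limit of minimizing paths has speed exactly
`l` (`gdist_eq_of_tendsto`). Such a curve is Lipschitz, and since `f x (y - x)` is at most nearly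
`gdist x y ^ p` at small scales (`exists_le_gdist_rpow`), its cost is at most `l ^ p`
(`cost_le_of_gdist_le`). This gives both existence of minimizers and compactness of minimizing
sequences.

Polylines are admissible for `F`, so the discrete minima are at least `l ^ p`. Conversely, a
constant-speed geodesic is sampled at about `1 / ε` times and its points are moved to nearby sample
points; velocities change little if the sample is dense at a small multiple of the scale `ε`
(`exists_polyPath_cost_le`). That density holds almost surely for large `n` by a covering bound and
Borel–Cantelli (`ae_eventually_forall_exists_dist_le`). Discrete minimizers are therefore a
minimizing sequence for `F`. -/

namespace RandomGeodesics

variable {d : ℕ} {D : Set (EuclideanSpace ℝ (Fin d))} {p : ℝ}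
  {f : EuclideanSpace ℝ (Fin d) → EuclideanSpace ℝ (Fin d) → ℝ}
  {x y z : EuclideanSpace ℝ (Fin d)} {γ η : ℝ → EuclideanSpace ℝ (Fin d)}

/-! ### Lipschitz paths and their derivatives -/

lemma cost_eq_setIntegral (f : EuclideanSpace ℝ (Fin d) → EuclideanSpace ℝ (Fin d) → ℝ)
    (γ : ℝ → EuclideanSpace ℝ (Fin d)) :
    cost f γ = ∫ t in Ioo (0 : ℝ) 1, f (γ t) (deriv γ t) := by
  rw [cost, intervalIntegral.integral_of_le zero_le_one, integral_Ioc_eq_integral_Ioo]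

lemma cost_congr (h : EqOn γ η (Icc 0 1)) : cost f γ = cost f η := by
  rw [cost_eq_setIntegral, cost_eq_setIntegral]
  refine setIntegral_congr_fun measurableSet_Ioo fun t ht => ?_
  have h1 : γ =ᶠ[𝓝 t] η := by
    filter_upwards [Icc_mem_nhds ht.1 ht.2] with s hs using h hs
  simp only [h1.deriv_eq, h1.eq_of_nhds]

lemma lipPaths_congr (h : EqOn γ η (Icc 0 1)) (hγ : γ ∈ lipPaths D x y) :
    η ∈ lipPaths D x y := by
  obtain ⟨⟨K, hK⟩, hD, h0, h1⟩ := hγ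
  refine ⟨⟨K, ?_⟩, fun t ht => h ht ▸ hD ht, ?_, ?_⟩
  · intro s hs t ht
    rw [← h hs, ← h ht]
    exact hK hs ht
  · rw [← h (by simp), h0]
  · rw [← h (by simp), h1]

lemma norm_deriv_le_of_lipschitzOnWith_Icc {K : NNReal} (hK : LipschitzOnWith K γ (Icc 0 1))
    {t : ℝ} (ht : t ∈ Ioo (0 : ℝ) 1) : ‖deriv γ t‖ ≤ K :=
  norm_deriv_le_of_lipschitzOn (Icc_mem_nhds ht.1 ht.2) hK

lemma integrable_deriv {K : NNReal} (hK : LipschitzOnWith K γ (Icc 0 1)) :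
    Integrable (deriv γ) (volume.restrict (Ioo 0 1)) := by
  refine Integrable.of_bound (measurable_deriv γ).aestronglyMeasurable K ?_
  filter_upwards [ae_restrict_mem measurableSet_Ioo] with t ht
  exact norm_deriv_le_of_lipschitzOnWith_Icc hK ht

lemma ae_hasDerivAt_of_lipschitzOnWith {K : NNReal} (hK : LipschitzOnWith K γ (Icc 0 1)) :
    ∀ᵐ t ∂(volume.restrict (Ioo (0 : ℝ) 1)), HasDerivAt γ (deriv γ t) t := by
  rw [ae_restrict_iff' measurableSet_Ioo]
  filter_upwards [hK.ae_differentiableWithinAt_of_mem_real] with t ht ht'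
  exact ((ht (Ioo_subset_Icc_self ht')).differentiableAt
    (Icc_mem_nhds ht'.1 ht'.2)).hasDerivAt

/-- Pairing with a fixed vector reduces this to real-valued Lipschitz functions, which are
absolutely continuous. -/
lemma integral_deriv_of_lipschitzOnWith {K : NNReal} (hK : LipschitzOnWith K γ (Icc 0 1)) :
    ∫ t in Ioo (0 : ℝ) 1, deriv γ t = γ 1 - γ 0 := by
  refine ext_inner_left ℝ fun v => ?_
  rw [← integral_inner (integrable_deriv hK) v]
  have h1 : LipschitzOnWith (‖innerSL ℝ v‖₊ * K) (fun t => inner ℝ v (γ t)) (uIcc 0 1) := by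
    rw [uIcc_of_le zero_le_one]
    exact (innerSL ℝ v).lipschitz.comp_lipschitzOnWith hK
  have h2 := h1.absolutelyContinuousOnInterval.integral_deriv_eq_sub
  rw [inner_sub_right, ← h2, intervalIntegral.integral_of_le zero_le_one,
    integral_Ioc_eq_integral_Ioo]
  refine integral_congr_ae ?_
  filter_upwards [ae_hasDerivAt_of_lipschitzOnWith hK] with t ht
  exact ((innerSL ℝ v).hasFDerivAt.comp_hasDerivAt t ht).deriv.symm

instance isProbabilityMeasure_restrict_Ioo_zero_one :
    IsProbabilityMeasure (volume.restrict (Ioo (0 : ℝ) 1)) := ⟨by simp⟩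

/-- Jensen's inequality along a Lipschitz path. -/
lemma convex_sub_le_integral {h : EuclideanSpace ℝ (Fin d) → ℝ} (hh : ConvexOn ℝ univ h)
    (hc : Continuous h) {K : NNReal} (hK : LipschitzOnWith K γ (Icc 0 1)) :
    Integrable (fun t => h (deriv γ t)) (volume.restrict (Ioo 0 1)) ∧
    h (γ 1 - γ 0) ≤ ∫ t in Ioo (0 : ℝ) 1, h (deriv γ t) := by
  have hi : Integrable (fun t => h (deriv γ t)) (volume.restrict (Ioo 0 1)) := by
    obtain ⟨C, hC⟩ := (isCompact_closedBall (0 : EuclideanSpace ℝ (Fin d)) K).exists_bound_of_continuousOn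
      hc.continuousOn
    refine Integrable.of_bound (hc.measurable.comp (measurable_deriv γ)).aestronglyMeasurable C ?_
    filter_upwards [ae_restrict_mem measurableSet_Ioo] with t ht
    exact hC _ (by simpa using norm_deriv_le_of_lipschitzOnWith_Icc hK ht)
  refine ⟨hi, ?_⟩
  rw [← integral_deriv_of_lipschitzOnWith hK]
  exact hh.map_integral_le hc.continuousOn isClosed_univ (by simp) (integrable_deriv hK) hi

/-! ### The integrand -/

lemma IsKernel.continuous_right (hf : IsKernel D p f) (hx : x ∈ D) : Continuous (f x) := by
  rw [← continuousOn_univ]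
  exact hf.continuousOn.comp (f := fun v => (x, v)) (by fun_prop) fun v _ => ⟨hx, mem_univ _⟩

lemma IsKernel.nonneg (hf : IsKernel D p f) (hx : x ∈ D) (v : EuclideanSpace ℝ (Fin d)) :
    0 ≤ f x v := by
  obtain ⟨m₁, m₂, h1, h2, h⟩ := hf.elliptic
  exact (by positivity : 0 ≤ m₁ * ‖v‖ ^ p).trans (h x hx v).1

lemma IsKernel.integrable (hf : IsKernel D p f) (hp : 0 ≤ p) {K : NNReal}
    (hK : LipschitzOnWith K γ (Icc 0 1)) (hD : MapsTo γ (Icc 0 1) D) :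
    Integrable (fun t => f (γ t) (deriv γ t)) (volume.restrict (Ioo 0 1)) := by
  obtain ⟨m₁, m₂, h1, h2, h⟩ := hf.elliptic
  refine Integrable.of_bound ?_ (m₂ * K ^ p) ?_
  -- Clamping the time to `[0,1]` keeps the base point in `D` for every real `t`, so measurability
  -- follows from continuity of `f` on `D ×ˢ univ`.
  · have hc : Continuous fun t => γ (projIcc (0 : ℝ) 1 zero_le_one t) :=
      hK.continuousOn.domRestrict.comp continuous_projIcc
    have hmem : ∀ t : ℝ, (γ (projIcc (0 : ℝ) 1 zero_le_one t), deriv γ t) ∈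
        D ×ˢ (univ : Set (EuclideanSpace ℝ (Fin d))) :=
      fun t => ⟨hD (projIcc (0 : ℝ) 1 zero_le_one t).2, mem_univ _⟩
    have hm : Measurable fun t => f (γ (projIcc (0 : ℝ) 1 zero_le_one t)) (deriv γ t) :=
      hf.continuousOn.domRestrict.measurable.comp
        ((hc.measurable.prodMk (measurable_deriv γ)).subtype_mk (h := hmem))
    refine hm.aestronglyMeasurable.congr ?_
    filter_upwards [ae_restrict_mem measurableSet_Ioo] with t ht
    rw [projIcc_of_mem zero_le_one (Ioo_subset_Icc_self ht)]
  · filter_upwards [ae_restrict_mem measurableSet_Ioo] with t ht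
    have hx := hD (Ioo_subset_Icc_self ht)
    rw [Real.norm_of_nonneg (hf.nonneg hx _)]
    refine (h _ hx _).2.trans ?_
    gcongr
    exact norm_deriv_le_of_lipschitzOnWith_Icc hK ht

lemma IsKernel.integrable_of_mem (hf : IsKernel D p f) (hp : 0 ≤ p) (hγ : γ ∈ lipPaths D x y) :
    Integrable (fun t => f (γ t) (deriv γ t)) (volume.restrict (Ioo 0 1)) := by
  obtain ⟨⟨K, hK⟩, hD, -⟩ := hγ
  exact hf.integrable hp hK hD

lemma IsKernel.cost_nonneg (hf : IsKernel D p f) (hD : MapsTo γ (Icc 0 1) D) :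
    0 ≤ cost f γ := by
  rw [cost_eq_setIntegral]
  exact setIntegral_nonneg measurableSet_Ioo fun t ht =>
    hf.nonneg (hD (Ioo_subset_Icc_self ht)) _

lemma cost_le_of_ae_le {C : ℝ} (hf : IsKernel D p f) (hp : 0 ≤ p) (hγ : γ ∈ lipPaths D x y)
    (h : ∀ᵐ t ∂(volume.restrict (Ioo (0 : ℝ) 1)), f (γ t) (deriv γ t) ≤ C) :
    cost f γ ≤ C := by
  rw [cost_eq_setIntegral]
  calc _ ≤ ∫ t in Ioo (0 : ℝ) 1, C :=
        integral_mono_ae (hf.integrable_of_mem hp hγ) (integrable_const _) h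
    _ = C := by simp

lemma le_cost_of_ae_le {C : ℝ} (hf : IsKernel D p f) (hp : 0 ≤ p) (hγ : γ ∈ lipPaths D x y)
    (h : ∀ᵐ t ∂(volume.restrict (Ioo (0 : ℝ) 1)), C ≤ f (γ t) (deriv γ t)) :
    C ≤ cost f γ := by
  rw [cost_eq_setIntegral]
  calc C = ∫ t in Ioo (0 : ℝ) 1, C := by simp
    _ ≤ _ := integral_mono_ae (integrable_const _) (hf.integrable_of_mem hp hγ) h

/-- Freezing the base point of the integrand along a path. -/
lemma IsKernel.frozen_le_cost (hf : IsKernel D p f) (hp : 0 ≤ p) (hγ : γ ∈ lipPaths D x y)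
    (hz : z ∈ D) {C : ℝ}
    (h : ∀ t ∈ Ioo (0 : ℝ) 1, f z (deriv γ t) ≤ C * f (γ t) (deriv γ t)) :
    f z (y - x) ≤ C * cost f γ := by
  have hi := hf.integrable_of_mem hp hγ
  obtain ⟨⟨K, hK⟩, hD, rfl, rfl⟩ := hγ
  obtain ⟨h1, h2⟩ := convex_sub_le_integral (hf.convexOn z hz) (hf.continuous_right hz) hK
  refine h2.trans ?_
  rw [cost_eq_setIntegral, ← integral_const_mul]
  exact setIntegral_mono_on h1 (hi.const_mul C) measurableSet_Ioo h

lemma convexOn_norm_rpow (hp : 1 ≤ p) :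
    ConvexOn ℝ univ fun v : EuclideanSpace ℝ (Fin d) => ‖v‖ ^ p := by
  refine ConvexOn.comp (g := fun r : ℝ => r ^ p) ((convexOn_rpow hp).subset ?_ ?_)
    (convexOn_norm convex_univ) ?_
  · rintro _ ⟨v, -, rfl⟩
    exact norm_nonneg v
  -- The range of the norm is `{0}` when `d = 0`; connectedness gives its convexity in every
  -- dimension.
  · exact (isPreconnected_univ.image _ continuous_norm.continuousOn).ordConnected.convex
  · rintro _ ⟨v, -, rfl⟩ _ ⟨w, -, rfl⟩ hvw
    exact Real.rpow_le_rpow (norm_nonneg v) hvw (by linarith)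

lemma norm_sub_rpow_le_cost (hf : IsKernel D p f) (hp : 1 ≤ p) {m₁ : ℝ} (hm : 0 < m₁)
    (h : ∀ x ∈ D, ∀ v, m₁ * ‖v‖ ^ p ≤ f x v) (hγ : γ ∈ lipPaths D x y) :
    m₁ * ‖y - x‖ ^ p ≤ cost f γ := by
  have hi := hf.integrable_of_mem (by linarith) hγ
  obtain ⟨⟨K, hK⟩, hD, rfl, rfl⟩ := hγ
  obtain ⟨h1, h2⟩ := convex_sub_le_integral (convexOn_norm_rpow hp)
    (continuous_norm.rpow_const fun _ => Or.inr (by linarith)) hK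
  calc _ ≤ m₁ * ∫ t in Ioo (0 : ℝ) 1, ‖deriv γ t‖ ^ p := by gcongr
    _ = ∫ t in Ioo (0 : ℝ) 1, m₁ * ‖deriv γ t‖ ^ p := (integral_const_mul _ _).symm
    _ ≤ cost f γ := by
      rw [cost_eq_setIntegral]
      exact setIntegral_mono_on (h1.const_mul _) hi measurableSet_Ioo fun t ht =>
        h _ (hD (Ioo_subset_Icc_self ht)) _

/-! ### Segments, restrictions and concatenations -/

lemma lineMap_mem_lipPaths (hD : Convex ℝ D) (hx : x ∈ D) (hy : y ∈ D) :
    (AffineMap.lineMap x y : ℝ → EuclideanSpace ℝ (Fin d)) ∈ lipPaths D x y := by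
  refine ⟨⟨_, (lipschitzWith_lineMap x y).lipschitzOnWith⟩, fun t ht => ?_, by simp, by simp⟩
  exact hD.segment_subset hx hy (by
    rw [segment_eq_image_lineMap]; exact mem_image_of_mem _ ht)

lemma deriv_lineMap_real (t : ℝ) :
    deriv (AffineMap.lineMap x y : ℝ → EuclideanSpace ℝ (Fin d)) t = y - x :=
  AffineMap.hasDerivAt_lineMap.deriv

lemma cost_lineMap_le (hf : IsKernel D p f) (hp : 0 ≤ p) (hD : Convex ℝ D) (hx : x ∈ D)
    (hy : y ∈ D) {m₂ : ℝ} (h : ∀ x ∈ D, ∀ v, f x v ≤ m₂ * ‖v‖ ^ p) :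
    cost f (AffineMap.lineMap x y : ℝ → EuclideanSpace ℝ (Fin d)) ≤ m₂ * ‖y - x‖ ^ p := by
  have hmem := lineMap_mem_lipPaths hD hx hy
  refine cost_le_of_ae_le hf hp hmem ?_
  filter_upwards [ae_restrict_mem measurableSet_Ioo] with t ht
  rw [deriv_lineMap_real]
  exact h _ (hmem.2.1 (Ioo_subset_Icc_self ht)) _

/-- The restriction of `γ` to `[s,t]`, reparametrised affinely over `[0,1]`. -/
def subPath (γ : ℝ → EuclideanSpace ℝ (Fin d)) (s t : ℝ) : ℝ → EuclideanSpace ℝ (Fin d) :=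
  fun u => γ (s + (t - s) * u)

lemma add_mul_mem_Icc {s t u : ℝ} (hs : 0 ≤ s) (hst : s ≤ t) (ht : t ≤ 1)
    (hu : u ∈ Icc (0 : ℝ) 1) : s + (t - s) * u ∈ Icc (0 : ℝ) 1 := by
  constructor <;> nlinarith [hu.1, hu.2]

lemma subPath_mem_lipPaths (hγ : γ ∈ lipPaths D x y) {s t : ℝ} (hs : 0 ≤ s) (hst : s ≤ t)
    (ht : t ≤ 1) : subPath γ s t ∈ lipPaths D (γ s) (γ t) := by
  obtain ⟨⟨K, hK⟩, hD, -, -⟩ := hγ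
  have hm : MapsTo (fun u : ℝ => s + (t - s) * u) (Icc 0 1) (Icc 0 1) := fun u hu =>
    add_mul_mem_Icc hs hst ht hu
  refine ⟨⟨K * (t - s).toNNReal, hK.comp (LipschitzWith.lipschitzOnWith ?_) hm⟩,
    hD.comp hm, by simp [subPath], by simp [subPath]⟩
  refine LipschitzWith.of_dist_le_mul fun u v => ?_
  rw [Real.coe_toNNReal _ (by linarith), Real.dist_eq, Real.dist_eq,
    ← abs_of_nonneg (sub_nonneg.2 hst), ← abs_mul]
  apply le_of_eq
  congr 1
  rw [abs_of_nonneg (sub_nonneg.2 hst)]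
  ring

lemma deriv_subPath (γ : ℝ → EuclideanSpace ℝ (Fin d)) (s t u : ℝ) :
    deriv (subPath γ s t) u = (t - s) • deriv γ (s + (t - s) * u) := by
  unfold subPath
  rw [deriv_comp_mul_left (t - s) (fun w => γ (s + w)) u, deriv_comp_const_add]

/-- Homogeneity contributes `(t - s) ^ p`, and the change of variables takes back one factor `t -
s`. -/
lemma cost_subPath (hf : IsKernel D p f) (hD : MapsTo γ (Icc 0 1) D) {s t : ℝ} (hs : 0 ≤ s)
    (hst : s < t) (ht : t ≤ 1) :
    cost f (subPath γ s t) = (t - s) ^ (p - 1) * ∫ u in s..t, f (γ u) (deriv γ u) := by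
  have hpos : 0 < t - s := sub_pos.2 hst
  have h1 : cost f (subPath γ s t) =
      ∫ u in (0 : ℝ)..1, (t - s) ^ p * f (γ ((t - s) * u + s)) (deriv γ ((t - s) * u + s)) := by
    refine intervalIntegral.integral_congr fun u hu => ?_
    rw [uIcc_of_le zero_le_one] at hu
    simp only [deriv_subPath]
    rw [subPath, hf.homogeneous _ (hD (add_mul_mem_Icc hs hst.le ht hu)) _ _ hpos, add_comm s]
  rw [h1, intervalIntegral.integral_const_mul,
    intervalIntegral.integral_comp_mul_add (fun u => f (γ u) (deriv γ u)) hpos.ne' s]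
  simp only [mul_zero, zero_add, mul_one, sub_add_cancel, smul_eq_mul]
  rw [Real.rpow_sub_one hpos.ne']
  field_simp

lemma intervalIntegrable_kernel (hf : IsKernel D p f) (hp : 0 ≤ p) (hγ : γ ∈ lipPaths D x y)
    {s t : ℝ} (hs : 0 ≤ s) (hst : s ≤ t) (ht : t ≤ 1) :
    IntervalIntegrable (fun u => f (γ u) (deriv γ u)) volume s t := by
  rw [intervalIntegrable_iff_integrableOn_Ioo_of_le hst]
  exact IntegrableOn.mono_set (hf.integrable_of_mem hp hγ) (Ioo_subset_Ioo hs ht)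

lemma lipschitzOnWith_Icc_trans {K : NNReal} {a b c : ℝ} (h1 : LipschitzOnWith K γ (Icc a b))
    (h2 : LipschitzOnWith K γ (Icc b c)) : LipschitzOnWith K γ (Icc a c) := by
  rw [lipschitzOnWith_iff_dist_le_mul] at *
  have key : ∀ s ∈ Icc a c, ∀ t ∈ Icc a c, s ≤ t → dist (γ s) (γ t) ≤ K * dist s t := by
    intro s hs t ht hst
    rcases le_total t b with htb | htb
    · exact h1 s ⟨hs.1, hst.trans htb⟩ t ⟨ht.1, htb⟩
    rcases le_total b s with hsb | hsb
    · exact h2 s ⟨hsb, hs.2⟩ t ⟨htb, ht.2⟩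
    · have e1 := h1 s ⟨hs.1, hsb⟩ b ⟨hs.1.trans hsb, le_rfl⟩
      have e2 := h2 b ⟨le_rfl, htb.trans ht.2⟩ t ⟨htb, ht.2⟩
      have e3 := dist_triangle (γ s) (γ b) (γ t)
      rw [Real.dist_eq, abs_of_nonpos (by linarith)] at *
      nlinarith
  intro s hs t ht
  rcases le_total s t with h | h
  · exact key s hs t ht h
  · rw [dist_comm, dist_comm s]
    exact key t ht s hs h

/-- Follow `γ` during `[0,θ]`, then `η` during `[θ,1]`. -/
noncomputable def concatPath (θ : ℝ) (γ η : ℝ → EuclideanSpace ℝ (Fin d)) : ℝ → EuclideanSpace ℝ (Fin d) :=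
  fun t => if t ≤ θ then γ (t / θ) else η ((t - θ) / (1 - θ))

lemma subPath_concatPath_left {θ : ℝ} (h0 : 0 < θ) :
    EqOn (subPath (concatPath θ γ η) 0 θ) γ (Icc 0 1) := by
  intro u hu
  have h : θ * u ≤ θ := by nlinarith [hu.2]
  simp [subPath, concatPath, h, h0.ne']

lemma subPath_concatPath_right {θ : ℝ} (h0 : 0 < θ) (h1 : θ < 1) (h : γ 1 = η 0) :
    EqOn (subPath (concatPath θ γ η) θ 1) η (Icc 0 1) := by
  intro u hu
  rcases hu.1.eq_or_lt with rfl | hu0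
  · simp [subPath, concatPath, h0.ne', h]
  · have h2 : ¬ θ + (1 - θ) * u ≤ θ := by nlinarith
    have h3 : 1 - θ ≠ 0 := by linarith
    simp only [subPath, concatPath, h2, if_false]
    congr 1
    field_simp
    ring

lemma lipschitzOnWith_of_subPath {s t : ℝ} (hst : s < t) {K : NNReal}
    (h : LipschitzOnWith K (subPath γ s t) (Icc 0 1)) :
    LipschitzOnWith (K / (t - s).toNNReal) γ (Icc s t) := by
  rw [lipschitzOnWith_iff_dist_le_mul] at *
  have hpos : 0 < t - s := sub_pos.2 hst
  have hm : ∀ u ∈ Icc s t, (u - s) / (t - s) ∈ Icc (0 : ℝ) 1 := fun u hu =>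
    ⟨div_nonneg (by linarith [hu.1]) hpos.le, (div_le_one hpos).2 (by linarith [hu.2])⟩
  have hv : ∀ u, subPath γ s t ((u - s) / (t - s)) = γ u := fun u => by
    simp only [subPath]
    congr 1
    field_simp
    ring
  intro u hu v hv'
  have := h _ (hm u hu) _ (hm v hv')
  rw [hv, hv] at this
  refine this.trans (le_of_eq ?_)
  rw [NNReal.coe_div, Real.coe_toNNReal _ hpos.le, Real.dist_eq, Real.dist_eq, ← sub_div,
    sub_sub_sub_cancel_right, abs_div, abs_of_pos hpos]
  ring

lemma concatPath_mem_lipPaths {θ : ℝ} (h0 : 0 < θ) (h1 : θ < 1) (hγ : γ ∈ lipPaths D x y)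
    (hη : η ∈ lipPaths D y z) : concatPath θ γ η ∈ lipPaths D x z := by
  have hyy : γ 1 = η 0 := by rw [hγ.2.2.2, hη.2.2.1]
  have l1 := lipPaths_congr (subPath_concatPath_left (γ := γ) (η := η) h0).symm hγ
  have l2 := lipPaths_congr (subPath_concatPath_right (γ := γ) (η := η) h0 h1 hyy).symm hη
  obtain ⟨⟨K₁, hK₁⟩, -⟩ := l1
  obtain ⟨⟨K₂, hK₂⟩, -⟩ := l2
  have e1 := lipschitzOnWith_of_subPath h0 hK₁
  have e2 := lipschitzOnWith_of_subPath h1 hK₂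
  refine ⟨⟨_, lipschitzOnWith_Icc_trans (e1.weaken (le_max_left _ _)) (e2.weaken (le_max_right _ _))⟩, ?_, ?_,
    ?_⟩
  · intro t ht
    simp only [concatPath]
    split_ifs with h
    · exact hγ.2.1 ⟨div_nonneg ht.1 h0.le, (div_le_one h0).2 h⟩
    · exact hη.2.1 ⟨div_nonneg (by linarith) (by linarith),
        (div_le_one (by linarith)).2 (by linarith [ht.2])⟩
  · simp [concatPath, h0.le, hγ.2.2.1]
  · have : (1 - θ) ≠ 0 := by linarith
    simp [concatPath, h1.not_ge, this, hη.2.2.2]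

lemma cost_concatPath (hf : IsKernel D p f) (hp : 0 ≤ p) {θ : ℝ} (h0 : 0 < θ) (h1 : θ < 1)
    (hγ : γ ∈ lipPaths D x y) (hη : η ∈ lipPaths D y z) :
    cost f (concatPath θ γ η) = cost f γ / θ ^ (p - 1) + cost f η / (1 - θ) ^ (p - 1) := by
  have hyy : γ 1 = η 0 := by rw [hγ.2.2.2, hη.2.2.1]
  have hm := concatPath_mem_lipPaths h0 h1 hγ hη
  have c1 := cost_subPath hf hm.2.1 le_rfl h0 h1.le
  have c2 := cost_subPath hf hm.2.1 h0.le h1 le_rfl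
  rw [cost_congr (subPath_concatPath_left h0), sub_zero] at c1
  rw [cost_congr (subPath_concatPath_right h0 h1 hyy)] at c2
  have hθ := (Real.rpow_pos_of_pos h0 (p - 1)).ne'
  have hθ' := (Real.rpow_pos_of_pos (sub_pos.2 h1) (p - 1)).ne'
  rw [c1, c2, mul_div_cancel_left₀ _ hθ, mul_div_cancel_left₀ _ hθ', cost,
    intervalIntegral.integral_add_adjacent_intervals
      (intervalIntegrable_kernel hf hp hm le_rfl h0.le h1.le)
      (intervalIntegrable_kernel hf hp hm h0.le h1.le le_rfl)]

end RandomGeodesics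

namespace RandomGeodesics

variable {d : ℕ} {D : Set (EuclideanSpace ℝ (Fin d))} {p : ℝ}
  {f : EuclideanSpace ℝ (Fin d) → EuclideanSpace ℝ (Fin d) → ℝ}
  {x y z : EuclideanSpace ℝ (Fin d)} {γ η : ℝ → EuclideanSpace ℝ (Fin d)}

/-! ### The geodesic distance -/

/-- The (asymmetric) geodesic distance of the integrand `f`: the `p`-th root of the infimum of the
cost over Lipschitz paths. -/
noncomputable def gdist (p : ℝ) (f : EuclideanSpace ℝ (Fin d) → EuclideanSpace ℝ (Fin d) → ℝ)
    (D : Set (EuclideanSpace ℝ (Fin d))) (x y : EuclideanSpace ℝ (Fin d)) : ℝ :=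
  (sInf (cost f '' lipPaths D x y)) ^ p⁻¹

lemma zero_mem_lowerBounds_cost (hf : IsKernel D p f) :
    0 ∈ lowerBounds (cost f '' lipPaths D x y) := by
  rintro _ ⟨γ, hγ, rfl⟩
  exact hf.cost_nonneg hγ.2.1

lemma sInf_cost_nonneg (hf : IsKernel D p f) : 0 ≤ sInf (cost f '' lipPaths D x y) :=
  Real.sInf_nonneg fun _ h => zero_mem_lowerBounds_cost hf h

lemma gdist_nonneg (hf : IsKernel D p f) : 0 ≤ gdist p f D x y :=
  Real.rpow_nonneg (sInf_cost_nonneg hf) _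

lemma gdist_rpow (hf : IsKernel D p f) (hp : 0 < p) :
    gdist p f D x y ^ p = sInf (cost f '' lipPaths D x y) :=
  Real.rpow_inv_rpow (sInf_cost_nonneg hf) hp.ne'

lemma gdist_rpow_le_cost (hf : IsKernel D p f) (hp : 0 < p) (hγ : γ ∈ lipPaths D x y) :
    gdist p f D x y ^ p ≤ cost f γ := by
  rw [gdist_rpow hf hp]
  exact csInf_le ⟨0, zero_mem_lowerBounds_cost hf⟩ (mem_image_of_mem _ hγ)

lemma le_gdist_rpow (hf : IsKernel D p f) (hp : 0 < p) (hD : Convex ℝ D) (hx : x ∈ D) (hy : y ∈ D)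
    {c : ℝ} (h : ∀ γ ∈ lipPaths D x y, c ≤ cost f γ) : c ≤ gdist p f D x y ^ p := by
  rw [gdist_rpow hf hp]
  refine le_csInf ⟨_, mem_image_of_mem _ (lineMap_mem_lipPaths hD hx hy)⟩ ?_
  rintro _ ⟨γ, hγ, rfl⟩
  exact h γ hγ

lemma exists_cost_lt_rpow (hf : IsKernel D p f) (hp : 0 < p) (hD : Convex ℝ D) (hx : x ∈ D)
    (hy : y ∈ D) {r : ℝ} (hr : gdist p f D x y < r) : ∃ γ ∈ lipPaths D x y, cost f γ < r ^ p := by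
  have h : sInf (cost f '' lipPaths D x y) < r ^ p := by
    rw [← gdist_rpow hf hp]
    exact Real.rpow_lt_rpow (gdist_nonneg hf) hr hp
  obtain ⟨_, ⟨γ, hγ, rfl⟩, hlt⟩ := exists_lt_of_csInf_lt
    ⟨_, mem_image_of_mem _ (lineMap_mem_lipPaths hD hx hy)⟩ h
  exact ⟨γ, hγ, hlt⟩

/-- The lower bound is Jensen's inequality for `‖·‖ ^ p`; the upper bound is the cost of the
segment, which lies in `D` by convexity. -/
lemma exists_gdist_bounds (hf : IsKernel D p f) (hp : 1 ≤ p) (hD : Convex ℝ D) :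
    ∃ C₁ C₂ : ℝ, 0 < C₁ ∧ 0 < C₂ ∧ ∀ x ∈ D, ∀ y ∈ D,
      C₁ * ‖y - x‖ ≤ gdist p f D x y ∧ gdist p f D x y ≤ C₂ * ‖y - x‖ := by
  obtain ⟨m₁, m₂, h1, h2, h⟩ := hf.elliptic
  have hp0 : 0 < p := by linarith
  refine ⟨m₁ ^ p⁻¹, m₂ ^ p⁻¹, Real.rpow_pos_of_pos h1 _, Real.rpow_pos_of_pos h2 _,
    fun x hx y hy => ⟨?_, ?_⟩⟩
  · rw [← Real.rpow_le_rpow_iff (by positivity) (gdist_nonneg hf) hp0,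
      Real.mul_rpow (by positivity) (by positivity), Real.rpow_inv_rpow h1.le hp0.ne']
    exact le_gdist_rpow hf hp0 hD hx hy fun γ hγ =>
      norm_sub_rpow_le_cost hf hp h1 (fun x hx v => (h x hx v).1) hγ
  · rw [← Real.rpow_le_rpow_iff (gdist_nonneg hf) (by positivity) hp0,
      Real.mul_rpow (by positivity) (by positivity), Real.rpow_inv_rpow h2.le hp0.ne']
    exact (gdist_rpow_le_cost hf hp0 (lineMap_mem_lipPaths hD hx hy)).trans
      (cost_lineMap_le hf hp0.le hD hx hy fun x hx v => (h x hx v).2)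

lemma gdist_triangle (hf : IsKernel D p f) (hp : 0 < p) (hD : Convex ℝ D) (hx : x ∈ D)
    (hy : y ∈ D) (hz : z ∈ D) :
    gdist p f D x z ≤ gdist p f D x y + gdist p f D y z := by
  refine le_of_forall_pos_le_add fun e he => ?_
  set r₁ := gdist p f D x y + e / 2 with hr₁
  set r₂ := gdist p f D y z + e / 2 with hr₂
  have h1 : 0 < r₁ := by linarith [gdist_nonneg (x := x) (y := y) hf]
  have h2 : 0 < r₂ := by linarith [gdist_nonneg (x := y) (y := z) hf]
  obtain ⟨γ, hγ, cγ⟩ := exists_cost_lt_rpow hf hp hD hx hy (r := r₁) (by linarith)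
  obtain ⟨η, hη, cη⟩ := exists_cost_lt_rpow hf hp hD hy hz (r := r₂) (by linarith)
  have hs : 0 < r₁ + r₂ := by linarith
  -- Time is shared in proportion to length, which is optimal: the two weighted costs then add up to
  -- exactly `(r₁ + r₂) ^ p`.
  have hθ0 : 0 < r₁ / (r₁ + r₂) := by positivity
  have hθ1 : r₁ / (r₁ + r₂) < 1 := (div_lt_one hs).2 (by linarith)
  have hθ' : 1 - r₁ / (r₁ + r₂) = r₂ / (r₁ + r₂) := by field_simp; ring
  have split : ∀ r : ℝ, 0 < r → r ^ p / (r / (r₁ + r₂)) ^ (p - 1) = r * (r₁ + r₂) ^ (p - 1) := by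
    intro r hr
    rw [Real.div_rpow hr.le hs.le, Real.rpow_sub_one hr.ne']
    have := (Real.rpow_pos_of_pos hr p).ne'
    field_simp
  have key : gdist p f D x z ^ p ≤ (r₁ + r₂) ^ p := by
    refine (gdist_rpow_le_cost hf hp (concatPath_mem_lipPaths hθ0 hθ1 hγ hη)).trans ?_
    rw [cost_concatPath hf hp.le hθ0 hθ1 hγ hη, hθ']
    calc _ ≤ r₁ ^ p / (r₁ / (r₁ + r₂)) ^ (p - 1) + r₂ ^ p / (r₂ / (r₁ + r₂)) ^ (p - 1) := by
          gcongr
      _ = (r₁ + r₂) * (r₁ + r₂) ^ (p - 1) := by rw [split _ h1, split _ h2]; ring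
      _ = (r₁ + r₂) ^ p := by
        rw [Real.rpow_sub_one hs.ne']
        field_simp
  rw [Real.rpow_le_rpow_iff (gdist_nonneg hf) hs.le hp] at key
  linarith

lemma gdist_rpow_le_integral (hf : IsKernel D p f) (hp : 0 < p) (hγ : γ ∈ lipPaths D x y)
    {s t : ℝ} (hs : 0 ≤ s) (hst : s < t) (ht : t ≤ 1) :
    gdist p f D (γ s) (γ t) ^ p ≤ (t - s) ^ (p - 1) * ∫ u in s..t, f (γ u) (deriv γ u) := by
  rw [← cost_subPath hf hγ.2.1 hs hst ht]
  exact gdist_rpow_le_cost hf hp (subPath_mem_lipPaths hγ hs hst.le ht)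

lemma integral_le_cost (hf : IsKernel D p f) (hp : 0 ≤ p) (hγ : γ ∈ lipPaths D x y)
    {s t : ℝ} (hs : 0 ≤ s) (hst : s ≤ t) (ht : t ≤ 1) :
    ∫ u in s..t, f (γ u) (deriv γ u) ≤ cost f γ := by
  refine intervalIntegral.integral_mono_interval hs hst ht ?_
    (intervalIntegrable_kernel hf hp hγ le_rfl zero_le_one le_rfl)
  filter_upwards [ae_restrict_mem measurableSet_Ioc] with u hu
  exact hf.nonneg (hγ.2.1 ⟨hu.1.le, hu.2⟩) _

lemma gdist_rpow_le_mul_cost (hf : IsKernel D p f) (hp : 0 < p) (hγ : γ ∈ lipPaths D x y)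
    {s t : ℝ} (hs : 0 ≤ s) (hst : s < t) (ht : t ≤ 1) :
    gdist p f D (γ s) (γ t) ^ p ≤ (t - s) ^ (p - 1) * cost f γ :=
  (gdist_rpow_le_integral hf hp hγ hs hst ht).trans <|
    mul_le_mul_of_nonneg_left (integral_le_cost hf hp.le hγ hs hst.le ht)
      (Real.rpow_nonneg (sub_nonneg.2 hst.le) _)

/-- A uniform Hölder bound for paths of bounded cost. -/
lemma exists_holder_bound (hf : IsKernel D p f) (hp : 1 ≤ p) (hD : Convex ℝ D) (M : ℝ) :
    ∃ C : ℝ, 0 < C ∧ ∀ x y γ, γ ∈ lipPaths D x y → cost f γ ≤ M →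
      ∀ s ∈ Icc (0 : ℝ) 1, ∀ t ∈ Icc (0 : ℝ) 1,
        ‖γ t - γ s‖ ≤ C * |t - s| ^ ((p - 1) / p) := by
  obtain ⟨C₁, C₂, h1, h2, h⟩ := exists_gdist_bounds hf hp hD
  have hp0 : 0 < p := by linarith
  -- The constant and the exponent come from the `p`-th root of `gdist_rpow_le_mul_cost`; `max M 1`
  -- only ensures positivity.
  set C := (max M 1) ^ p⁻¹ / C₁ with hC
  have hM : 0 < max M 1 := lt_max_of_lt_right one_pos
  have hC0 : 0 < C := div_pos (Real.rpow_pos_of_pos hM _) h1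
  refine ⟨C, hC0, fun x y γ hγ hcost => ?_⟩
  have key : ∀ s ∈ Icc (0 : ℝ) 1, ∀ t ∈ Icc (0 : ℝ) 1, s < t →
      ‖γ t - γ s‖ ≤ C * |t - s| ^ ((p - 1) / p) := by
    intro s hs t ht hst
    have hpos : 0 < t - s := sub_pos.2 hst
    have e1 := (h _ (hγ.2.1 hs) _ (hγ.2.1 ht)).1
    have e2 : gdist p f D (γ s) (γ t) ≤ (max M 1) ^ p⁻¹ * (t - s) ^ ((p - 1) / p) := by
      rw [← Real.rpow_le_rpow_iff (gdist_nonneg hf) (by positivity) hp0,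
        Real.mul_rpow (by positivity) (by positivity), Real.rpow_inv_rpow hM.le hp0.ne',
        ← Real.rpow_mul hpos.le, div_mul_cancel₀ _ hp0.ne', mul_comm]
      refine (gdist_rpow_le_mul_cost hf hp0 hγ hs.1 hst ht.2).trans ?_
      gcongr
      exact hcost.trans (le_max_left _ _)
    rw [abs_of_pos hpos, hC, div_mul_eq_mul_div, le_div_iff₀ h1, mul_comm]
    exact e1.trans e2
  intro s hs t ht
  rcases lt_trichotomy s t with hst | rfl | hst
  · exact key s hs t ht hst
  · simpa using by positivity
  · rw [norm_sub_rev, abs_sub_comm]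
    exact key t ht s hs hst

/-! ### Comparison with the integrand at small scales -/

lemma IsKernel.apply_zero (hf : IsKernel D p f) (hp : 0 < p) (hx : x ∈ D) : f x 0 = 0 := by
  obtain ⟨m₁, m₂, h1, h2, h⟩ := hf.elliptic
  have := h x hx 0
  rw [norm_zero, Real.zero_rpow hp.ne', mul_zero, mul_zero] at this
  exact le_antisymm this.2 this.1

/-- Uniform continuity on the compact set `D ×ˢ sphere 0 1` extends to all velocities by
homogeneity. -/
lemma IsKernel.exists_uniform_modulus (hf : IsKernel D p f) (hp : 0 < p) (hD : IsCompact D)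
    {κ : ℝ} (hκ : 0 < κ) :
    ∃ r > 0, ∀ x ∈ D, ∀ y ∈ D, dist x y < r → ∀ v, f x v ≤ f y v + κ * ‖v‖ ^ p := by
  have hS : IsCompact (D ×ˢ Metric.sphere (0 : EuclideanSpace ℝ (Fin d)) 1) :=
    hD.prod (isCompact_sphere _ _)
  have hu := hS.uniformContinuousOn_of_continuous
    (hf.continuousOn.mono (prod_mono_right (subset_univ _)))
  obtain ⟨r, hr, h⟩ := Metric.uniformContinuousOn_iff.1 hu κ hκ
  refine ⟨r, hr, fun x hx y hy hxy v => ?_⟩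
  rcases eq_or_ne v 0 with rfl | hv
  · simp [hf.apply_zero hp hx, hf.apply_zero hp hy, Real.zero_rpow hp.ne']
  have hn : 0 < ‖v‖ := norm_pos_iff.2 hv
  have hw : ‖v‖⁻¹ • v ∈ Metric.sphere (0 : EuclideanSpace ℝ (Fin d)) 1 := by
    simp [norm_smul, hn.ne']
  have e := h (x, ‖v‖⁻¹ • v) ⟨hx, hw⟩ (y, ‖v‖⁻¹ • v) ⟨hy, hw⟩ (by simpa [Prod.dist_eq] using hxy)
  rw [Real.dist_eq] at e
  have hv' : v = ‖v‖ • ‖v‖⁻¹ • v := by rw [smul_smul, mul_inv_cancel₀ hn.ne', one_smul]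
  have ex := hf.homogeneous x hx (‖v‖⁻¹ • v) _ hn
  have ey := hf.homogeneous y hy (‖v‖⁻¹ • v) _ hn
  rw [← hv'] at ex ey
  rw [ex, ey, mul_comm κ, ← mul_add]
  exact mul_le_mul_of_nonneg_left (by linarith [(abs_lt.1 e).2]) (by positivity)

/-- At small scales the geodesic distance is bounded below by the integrand. -/
lemma exists_le_gdist_rpow (hf : IsKernel D p f) (hp : 1 ≤ p) (hD : Convex ℝ D)
    (hDc : IsCompact D) {κ : ℝ} (hκ : 0 < κ) :
    ∃ r > 0, ∀ x ∈ D, ∀ y ∈ D, ‖y - x‖ < r →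
      f x (y - x) ≤ (1 + κ) * gdist p f D x y ^ p := by
  obtain ⟨m₁, m₂, h1, h2, h⟩ := hf.elliptic
  have hp0 : 0 < p := by linarith
  -- The error `κ * m₁ * ‖v‖ ^ p` of freezing the base point is at most `κ` times the integrand, by
  -- ellipticity.
  obtain ⟨r, hr, hmod⟩ := hf.exists_uniform_modulus hp0 hDc (mul_pos hκ h1)
  have hc : 0 < (m₂ / m₁) ^ p⁻¹ := by positivity
  refine ⟨r / (m₂ / m₁) ^ p⁻¹, by positivity, fun x hx y hy hxy => ?_⟩
  rw [lt_div_iff₀ hc] at hxy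
  rw [← div_le_iff₀' (by linarith)]
  refine le_gdist_rpow hf hp0 hD hx hy fun γ hγ => ?_
  rw [div_le_iff₀' (by linarith)]
  -- A path at least as expensive as `m₂ * ‖y - x‖ ^ p` satisfies the bound at once. A cheaper one
  -- stays within `(m₂ / m₁) ^ p⁻¹ * ‖y - x‖` of `x`, where the integrand may be frozen at `x`.
  rcases le_or_gt (m₂ * ‖y - x‖ ^ p) (cost f γ) with hlarge | hsmall
  · have := (h x hx (y - x)).2
    nlinarith [hf.cost_nonneg hγ.2.1]
  refine hf.frozen_le_cost hp0.le hγ hx fun t ht => ?_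
  have hmem := hγ.2.1 (Ioo_subset_Icc_self ht)
  have hclose : dist x (γ t) < r := by
    refine lt_of_le_of_lt ?_ hxy
    have e1 := norm_sub_rpow_le_cost hf hp h1 (fun x hx v => (h x hx v).1)
      (subPath_mem_lipPaths hγ le_rfl ht.1.le ht.2.le)
    rw [cost_subPath hf hγ.2.1 le_rfl ht.1 ht.2.le, sub_zero, hγ.2.2.1] at e1
    have e2 := integral_le_cost hf hp0.le hγ le_rfl ht.1.le ht.2.le
    have e3 : t ^ (p - 1) ≤ 1 := Real.rpow_le_one ht.1.le ht.2.le (by linarith)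
    have e4 : 0 ≤ t ^ (p - 1) := Real.rpow_nonneg ht.1.le _
    have e5 : m₁ * ‖γ t - x‖ ^ p ≤ m₂ * ‖y - x‖ ^ p := by
      nlinarith [hf.cost_nonneg hγ.2.1]
    rw [dist_comm, dist_eq_norm,
      ← Real.rpow_le_rpow_iff (norm_nonneg _) (by positivity) hp0,
      Real.mul_rpow (norm_nonneg _) hc.le, Real.rpow_inv_rpow (by positivity) hp0.ne',
      mul_div_assoc', le_div_iff₀ h1]
    linarith
  have := hmod x hx _ hmem hclose (deriv γ t)
  have := (h _ hmem (deriv γ t)).1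
  nlinarith

end RandomGeodesics

namespace RandomGeodesics

variable {d : ℕ} {D : Set (EuclideanSpace ℝ (Fin d))} {p : ℝ}
  {f : EuclideanSpace ℝ (Fin d) → EuclideanSpace ℝ (Fin d) → ℝ}
  {x y z a b : EuclideanSpace ℝ (Fin d)} {γ η : ℝ → EuclideanSpace ℝ (Fin d)}

/-! ### Limits of minimizing sequences are geodesics -/

/-- The graph of `u ↦ u ^ p` lies above its tangent at `l`: Bernoulli's inequality for `u / l`. -/
lemma mul_rpow_sub_one_le {u l : ℝ} (hp : 1 < p) (hu : 0 ≤ u) (hl : 0 ≤ l) :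
    p * l ^ (p - 1) * u ≤ u ^ p + (p - 1) * l ^ p := by
  rcases hl.eq_or_lt with rfl | hl
  · rw [Real.zero_rpow (by linarith), Real.zero_rpow (by linarith)]
    simpa using Real.rpow_nonneg hu p
  · have h := one_add_mul_self_le_rpow_one_add (s := u / l - 1)
      (by linarith [div_nonneg hu hl.le]) hp.le
    rw [add_sub_cancel, Real.div_rpow hu hl.le, le_div_iff₀ (by positivity)] at h
    rw [Real.rpow_sub_one hl.ne']
    calc _ = (1 + p * (u / l - 1)) * l ^ p + (p - 1) * l ^ p := by field_simp; ring
      _ ≤ _ := by linarith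

/-- Strict convexity: the tangent at `l` touches the graph only at `l`. -/
lemma eq_of_rpow_add_le {u l : ℝ} (hp : 1 < p) (hu : 0 ≤ u) (hl : 0 ≤ l)
    (h : u ^ p + (p - 1) * l ^ p ≤ p * l ^ (p - 1) * u) : u = l := by
  rcases hl.eq_or_lt with rfl | hl
  · rw [Real.zero_rpow (by linarith), Real.zero_rpow (by linarith)] at h
    have h0 : u ^ p = 0 := le_antisymm (by simpa using h) (Real.rpow_nonneg hu p)
    exact (Real.rpow_eq_zero hu (by linarith)).1 h0
  · by_contra hne
    have hlt := one_add_mul_self_lt_rpow_one_add (s := u / l - 1)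
      (by linarith [div_nonneg hu hl.le])
      (fun h0 => hne ((div_eq_one_iff_eq hl.ne').1 (by linarith))) hp
    rw [add_sub_cancel, Real.div_rpow hu hl.le, lt_div_iff₀ (by positivity)] at hlt
    rw [Real.rpow_sub_one hl.ne'] at h
    have : p * (l ^ p / l) * u = (1 + p * (u / l - 1)) * l ^ p + (p - 1) * l ^ p := by
      field_simp; ring
    linarith

lemma gdist_self (hf : IsKernel D p f) (hp : 1 ≤ p) (hD : Convex ℝ D) (hx : x ∈ D) :
    gdist p f D x x = 0 := by
  obtain ⟨C₁, C₂, h1, h2, h⟩ := exists_gdist_bounds hf hp hD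
  have := (h x hx x hx).2
  rw [sub_self, norm_zero, mul_zero] at this
  exact le_antisymm this (gdist_nonneg hf)

/-- Since `gdist` is not symmetric, the triangle inequality is used in both directions at each
endpoint. -/
lemma tendsto_gdist (hf : IsKernel D p f) (hp : 1 ≤ p) (hD : Convex ℝ D)
    {u v : ℕ → EuclideanSpace ℝ (Fin d)} (hu : ∀ n, u n ∈ D) (hv : ∀ n, v n ∈ D) (hx : x ∈ D)
    (hy : y ∈ D) (hux : Tendsto u atTop (𝓝 x)) (hvy : Tendsto v atTop (𝓝 y)) :
    Tendsto (fun n => gdist p f D (u n) (v n)) atTop (𝓝 (gdist p f D x y)) := by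
  obtain ⟨C₁, C₂, h1, h2, h⟩ := exists_gdist_bounds hf hp hD
  have hp0 : 0 < p := by linarith
  rw [tendsto_iff_dist_tendsto_zero]
  have hlim : Tendsto (fun n => C₂ * ‖u n - x‖ + C₂ * ‖v n - y‖) atTop (𝓝 0) := by
    simpa using ((tendsto_iff_norm_sub_tendsto_zero.1 hux).const_mul C₂).add
      ((tendsto_iff_norm_sub_tendsto_zero.1 hvy).const_mul C₂)
  refine squeeze_zero (fun _ => dist_nonneg) (fun n => ?_) hlim
  rw [Real.dist_eq, abs_le]
  have t1 := gdist_triangle hf hp0 hD hx (hu n) hy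
  have t2 := gdist_triangle hf hp0 hD (hu n) (hv n) hy
  have t3 := gdist_triangle hf hp0 hD (hu n) hx (hv n)
  have t4 := gdist_triangle hf hp0 hD hx hy (hv n)
  have b1 := (h _ hx _ (hu n)).2
  have b2 := (h _ (hu n) _ hx).2
  have b3 := (h _ (hv n) _ hy).2
  have b4 := (h _ hy _ (hv n)).2
  rw [norm_sub_rev] at b2 b3
  constructor <;> linarith

/-- The tangent inequality at the mean speed `gdist / (t - s)`, whose `p`-th power times `t - s` is
at most the cost spent on `[s,t]`. -/
lemma mul_gdist_le_integral_add (hf : IsKernel D p f) (hp : 1 < p) (hD : Convex ℝ D)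
    (hγ : γ ∈ lipPaths D x y) {l s t : ℝ} (hl : 0 ≤ l) (hs : 0 ≤ s) (hst : s ≤ t) (ht : t ≤ 1) :
    p * l ^ (p - 1) * gdist p f D (γ s) (γ t) ≤
      (∫ u in s..t, f (γ u) (deriv γ u)) + (p - 1) * l ^ p * (t - s) := by
  rcases hst.eq_or_lt with rfl | hst
  · simp [gdist_self hf hp.le hD (hγ.2.1 ⟨hs, ht⟩)]
  have hpos : 0 < t - s := sub_pos.2 hst
  have h1 := gdist_rpow_le_integral hf (by linarith) hγ hs hst ht
  have hg : 0 ≤ gdist p f D (γ s) (γ t) := gdist_nonneg hf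
  have h2 := mul_rpow_sub_one_le hp (div_nonneg hg hpos.le) hl
  rw [Real.div_rpow hg hpos.le] at h2
  rw [Real.rpow_sub_one hpos.ne', div_mul_eq_mul_div, le_div_iff₀ hpos] at h1
  have h3 : gdist p f D (γ s) (γ t) ^ p / (t - s) ^ p * (t - s) ≤
      ∫ u in s..t, f (γ u) (deriv γ u) := by
    rw [div_mul_eq_mul_div, div_le_iff₀ (by positivity)]
    linarith
  calc _ = p * l ^ (p - 1) * (gdist p f D (γ s) (γ t) / (t - s)) * (t - s) := by field_simp
    _ ≤ (gdist p f D (γ s) (γ t) ^ p / (t - s) ^ p + (p - 1) * l ^ p) * (t - s) := by gcongr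
    _ ≤ _ := by linarith

/-- A path of almost minimal cost has almost constant speed for the geodesic distance. -/
lemma speed_defect_le (hf : IsKernel D p f) (hp : 1 < p) (hD : Convex ℝ D)
    (hγ : γ ∈ lipPaths D a b) {s t : ℝ} (hs : 0 ≤ s) (hst : s < t) (ht : t ≤ 1) :
    (t - s) * ((gdist p f D (γ s) (γ t) / (t - s)) ^ p + (p - 1) * gdist p f D a b ^ p -
      p * gdist p f D a b ^ (p - 1) * (gdist p f D (γ s) (γ t) / (t - s))) ≤
      cost f γ - gdist p f D a b ^ p := by
  have hp0 : 0 < p := by linarith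
  have hpos : 0 < t - s := sub_pos.2 hst
  have hs1 : s ≤ 1 := hst.le.trans ht
  have ht0 : 0 ≤ t := hs.trans hst.le
  set l := gdist p f D a b with hl
  set g := gdist p f D (γ s) (γ t) with hg
  have hl0 : 0 ≤ l := gdist_nonneg hf
  have hg0 : 0 ≤ g := gdist_nonneg hf
  -- The cost is bounded below by tangents on `[0,s]` and `[t,1]`, and by the full power of the mean
  -- speed on `[s,t]`. The triangle inequality along `a`, `γ s`, `γ t`, `b` then leaves `l ^ p` plus
  -- the tangent defect on `[s,t]`.
  have i1 := mul_gdist_le_integral_add hf hp hD hγ hl0 le_rfl hs hs1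
  have i3 := mul_gdist_le_integral_add hf hp hD hγ hl0 ht0 ht le_rfl
  have i2 := gdist_rpow_le_integral hf hp0 hγ hs hst ht
  rw [← hg, Real.rpow_sub_one hpos.ne', div_mul_eq_mul_div, le_div_iff₀ hpos] at i2
  have i2' : (t - s) * (g / (t - s)) ^ p ≤ ∫ u in s..t, f (γ u) (deriv γ u) := by
    rw [Real.div_rpow hg0 hpos.le, mul_div_assoc', div_le_iff₀ (by positivity)]
    linarith
  have hsum : cost f γ = (∫ u in (0 : ℝ)..s, f (γ u) (deriv γ u)) +
      (∫ u in s..t, f (γ u) (deriv γ u)) + ∫ u in t..(1 : ℝ), f (γ u) (deriv γ u) := by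
    rw [intervalIntegral.integral_add_adjacent_intervals
        (intervalIntegrable_kernel hf hp0.le hγ le_rfl hs hs1)
        (intervalIntegrable_kernel hf hp0.le hγ hs hst.le ht),
      intervalIntegral.integral_add_adjacent_intervals
        (intervalIntegrable_kernel hf hp0.le hγ le_rfl ht0 ht)
        (intervalIntegrable_kernel hf hp0.le hγ ht0 ht le_rfl), cost]
  have hms := hγ.2.1 ⟨hs, hs1⟩
  have hmt := hγ.2.1 ⟨ht0, ht⟩
  have hm0 := hγ.2.1 (left_mem_Icc.2 zero_le_one)
  have hm1 := hγ.2.1 (right_mem_Icc.2 zero_le_one)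
  have t1 := gdist_triangle hf hp0 hD hm0 hms hm1
  have t2 := gdist_triangle hf hp0 hD hms hmt hm1
  rw [hγ.2.2.1] at i1 hm0 t1
  rw [hγ.2.2.2] at i3 hm1 t1 t2
  rw [← hl] at t1
  rw [← hg] at t2
  have hc : 0 ≤ p * l ^ (p - 1) := by positivity
  have hll : l ^ (p - 1) * l = l ^ p := by
    rcases hl0.eq_or_lt with h | h
    · rw [← h, mul_zero, Real.zero_rpow hp0.ne']
    · rw [Real.rpow_sub_one h.ne']
      field_simp
  have htri := mul_le_mul_of_nonneg_left (show l ≤ gdist p f D a (γ s) +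
    (g + gdist p f D (γ t) b) by linarith) hc
  have e1 : (t - s) * (p * l ^ (p - 1) * (g / (t - s))) = p * l ^ (p - 1) * g := by field_simp
  rw [mul_sub, mul_add, e1]
  have e2 : p * l ^ (p - 1) * l = p * l ^ p := by rw [mul_assoc, hll]
  rw [e2] at htri
  nlinarith

/-- The speed defect is bounded by the excess cost, which tends to `0`; the limit is thus an
equality case of the tangent inequality. -/
lemma gdist_eq_of_tendsto (hf : IsKernel D p f) (hp : 1 < p) (hD : Convex ℝ D) (hDc : IsClosed D)
    {γ : ℕ → ℝ → EuclideanSpace ℝ (Fin d)} (hγ : ∀ n, γ n ∈ lipPaths D a b)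
    (hcost : Tendsto (fun n => cost f (γ n)) atTop (𝓝 (gdist p f D a b ^ p)))
    {γ₀ : ℝ → EuclideanSpace ℝ (Fin d)}
    (hlim : ∀ t ∈ Icc (0 : ℝ) 1, Tendsto (fun n => γ n t) atTop (𝓝 (γ₀ t)))
    {s t : ℝ} (hs : 0 ≤ s) (hst : s < t) (ht : t ≤ 1) :
    gdist p f D (γ₀ s) (γ₀ t) = gdist p f D a b * (t - s) := by
  have hpos : 0 < t - s := sub_pos.2 hst
  have hsm : s ∈ Icc (0 : ℝ) 1 := ⟨hs, hst.le.trans ht⟩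
  have htm : t ∈ Icc (0 : ℝ) 1 := ⟨hs.trans hst.le, ht⟩
  have hg := tendsto_gdist hf hp.le hD (fun n => (hγ n).2.1 hsm) (fun n => (hγ n).2.1 htm)
    (hDc.mem_of_tendsto (hlim s hsm) (Eventually.of_forall fun n => (hγ n).2.1 hsm))
    (hDc.mem_of_tendsto (hlim t htm) (Eventually.of_forall fun n => (hγ n).2.1 htm))
    (hlim s hsm) (hlim t htm)
  have hg' := hg.div_const (t - s)
  have hlhs := (((hg'.rpow_const (Or.inr (by linarith : 0 ≤ p))).add_const
    ((p - 1) * gdist p f D a b ^ p)).sub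
      (hg'.const_mul (p * gdist p f D a b ^ (p - 1)))).const_mul (t - s)
  have hrhs := hcost.sub_const (gdist p f D a b ^ p)
  rw [sub_self] at hrhs
  have hle := le_of_tendsto_of_tendsto' hlhs hrhs fun n => speed_defect_le hf hp hD (hγ n) hs hst ht
  have h := eq_of_rpow_add_le hp (div_nonneg (gdist_nonneg hf) hpos.le) (gdist_nonneg hf)
    (by nlinarith : (gdist p f D (γ₀ s) (γ₀ t) / (t - s)) ^ p + (p - 1) * gdist p f D a b ^ p ≤ _)
  rwa [div_eq_iff hpos.ne'] at h

/-- A curve whose speed for the geodesic distance is at most `l` is a Lipschitz path. -/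
lemma exists_lipschitzOnWith_of_gdist_le (hf : IsKernel D p f) (hp : 1 ≤ p) (hD : Convex ℝ D)
    (hmem : MapsTo γ (Icc 0 1) D) {l : ℝ} (hl : 0 ≤ l)
    (hspeed : ∀ s t, 0 ≤ s → s < t → t ≤ 1 → gdist p f D (γ s) (γ t) ≤ l * (t - s)) :
    ∃ K, LipschitzOnWith K γ (Icc 0 1) := by
  obtain ⟨C₁, C₂, h1, h2, h⟩ := exists_gdist_bounds hf hp hD
  refine ⟨(l / C₁).toNNReal, ?_⟩
  rw [lipschitzOnWith_iff_dist_le_mul, Real.coe_toNNReal _ (by positivity)]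
  have key : ∀ s ∈ Icc (0 : ℝ) 1, ∀ t ∈ Icc (0 : ℝ) 1, s < t →
      dist (γ s) (γ t) ≤ l / C₁ * dist s t := by
    intro s hs t ht hst
    have e1 := (h _ (hmem hs) _ (hmem ht)).1
    have e2 := hspeed s t hs.1 hst ht.2
    rw [dist_comm, dist_eq_norm, dist_comm, Real.dist_eq, abs_of_pos (sub_pos.2 hst),
      div_mul_eq_mul_div, le_div_iff₀ h1]
    linarith
  intro s hs t ht
  rcases lt_trichotomy s t with hst | rfl | hst
  · exact key s hs t ht hst
  · simp
  · rw [dist_comm, dist_comm s]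
    exact key t ht s hs hst

/-- At a point of differentiability, `exists_le_gdist_rpow` bounds the integrand at the difference
quotient by `(1 + κ) * l ^ p`. Quotients are taken from the right because the speed bound concerns
forward distances only. -/
lemma cost_le_of_gdist_le (hf : IsKernel D p f) (hp : 1 ≤ p) (hD : Convex ℝ D)
    (hDc : IsCompact D) (hγ : γ ∈ lipPaths D a b) {l : ℝ} (hl : 0 ≤ l)
    (hspeed : ∀ s t, 0 ≤ s → s < t → t ≤ 1 → gdist p f D (γ s) (γ t) ≤ l * (t - s)) :
    cost f γ ≤ l ^ p := by
  have hp0 : 0 < p := by linarith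
  refine cost_le_of_ae_le hf hp0.le hγ ?_
  obtain ⟨K, hK⟩ := hγ.1
  filter_upwards [ae_hasDerivAt_of_lipschitzOnWith hK, ae_restrict_mem measurableSet_Ioo]
    with t hderiv ht
  have htm := Ioo_subset_Icc_self ht
  have hslope : Tendsto (fun h : ℝ => h⁻¹ • (γ (t + h) - γ t)) (𝓝[>] 0) (𝓝 (deriv γ t)) :=
    hderiv.tendsto_slope_zero_right
  have hcont : ContinuousAt (fun h : ℝ => γ (t + h)) 0 := by
    have : ContinuousAt γ (t + 0) := by simpa using hderiv.continuousAt
    exact ContinuousAt.comp this (by fun_prop)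
  have hcont' : Tendsto (fun h : ℝ => ‖γ (t + h) - γ t‖) (𝓝[>] 0) (𝓝 0) := by
    have : Tendsto (fun h : ℝ => γ (t + h)) (𝓝[>] 0) (𝓝 (γ t)) := by
      simpa using hcont.tendsto.mono_left nhdsWithin_le_nhds
    exact tendsto_iff_norm_sub_tendsto_zero.1 this
  have hfl : Tendsto (fun h : ℝ => f (γ t) (h⁻¹ • (γ (t + h) - γ t))) (𝓝[>] 0)
      (𝓝 (f (γ t) (deriv γ t))) :=
    ((hf.continuous_right (hγ.2.1 htm)).tendsto _).comp hslope
  have key : ∀ κ > 0, f (γ t) (deriv γ t) ≤ (1 + κ) * l ^ p := by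
    intro κ hκ
    obtain ⟨r, hr, hloc⟩ := exists_le_gdist_rpow hf hp hD hDc hκ
    refine le_of_tendsto hfl ?_
    have h1 : ∀ᶠ h : ℝ in 𝓝[>] 0, t + h < 1 := by
      have : ∀ᶠ h : ℝ in 𝓝 0, t + h < 1 :=
        (continuous_const.add continuous_id).tendsto' (0 : ℝ) t (by simp) |>.eventually_lt_const ht.2
      exact this.filter_mono nhdsWithin_le_nhds
    filter_upwards [h1, hcont'.eventually_lt_const hr, self_mem_nhdsWithin] with h hh1 hhr hh0
    have hpos : (0 : ℝ) < h := hh0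
    have hm : γ (t + h) ∈ D := hγ.2.1 ⟨by linarith [ht.1], hh1.le⟩
    have e1 := hloc _ (hγ.2.1 htm) _ hm hhr
    have e2 := hspeed t (t + h) ht.1.le (by linarith) hh1.le
    rw [add_sub_cancel_left] at e2
    have e3 := Real.rpow_le_rpow (gdist_nonneg hf) e2 hp0.le
    rw [Real.mul_rpow hl hpos.le] at e3
    rw [hf.homogeneous _ (hγ.2.1 htm) _ _ (inv_pos.2 hpos), Real.inv_rpow hpos.le,
      inv_mul_le_iff₀ (by positivity)]
    nlinarith
  have hlim : Tendsto (fun κ : ℝ => (1 + κ) * l ^ p) (𝓝[>] 0) (𝓝 (l ^ p)) := by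
    have : Tendsto (fun κ : ℝ => (1 + κ) * l ^ p) (𝓝 0) (𝓝 (l ^ p)) :=
      Continuous.tendsto' (by fun_prop) _ _ (by simp)
    exact this.mono_left nhdsWithin_le_nhds
  exact ge_of_tendsto hlim (eventually_mem_nhdsWithin.mono fun κ hκ => key κ hκ)

/-- Paths of bounded cost form a precompact family for uniform convergence. -/
lemma exists_subseq_tendstoUniformlyOn (hf : IsKernel D p f) (hp : 1 < p) (hD : Convex ℝ D)
    (hDc : IsCompact D) {γ : ℕ → ℝ → EuclideanSpace ℝ (Fin d)}
    (hγ : ∀ n, γ n ∈ lipPaths D a b) {M : ℝ} (hM : ∀ n, cost f (γ n) ≤ M) :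
    ∃ ψ : ℕ → ℕ, StrictMono ψ ∧ ∃ γ₀ : ℝ → EuclideanSpace ℝ (Fin d),
      TendstoUniformlyOn (fun k => γ (ψ k)) γ₀ atTop (Icc 0 1) := by
  obtain ⟨C, hC, hH⟩ := exists_holder_bound hf hp.le hD M
  have hcont : ∀ n, Continuous fun t : Icc (0 : ℝ) 1 => γ n t := fun n => by
    obtain ⟨K, hK⟩ := (hγ n).1
    exact hK.continuousOn.domRestrict
  let g : ℕ → BoundedContinuousFunction (Icc (0 : ℝ) 1) (EuclideanSpace ℝ (Fin d)) := fun n =>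
    BoundedContinuousFunction.mkOfCompact ⟨fun t => γ n t, hcont n⟩
  have hcomp : IsCompact (closure (range g)) := by
    refine BoundedContinuousFunction.arzela_ascoli D hDc _ ?_ ?_
    · rintro _ t ⟨n, rfl⟩
      exact (hγ n).2.1 t.2
    · refine Metric.equicontinuous_of_continuity_modulus (fun r => C * |r| ^ ((p - 1) / p)) ?_ _ ?_
      · have hq : 0 < (p - 1) / p := div_pos (by linarith) (by linarith)
        refine Continuous.tendsto' ?_ _ _ (by simp [Real.zero_rpow hq.ne'])
        exact continuous_const.mul (continuous_abs.rpow_const fun _ => Or.inr hq.le)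
      · rintro s t ⟨_, n, rfl⟩
        rw [dist_comm, dist_eq_norm]
        have := hH a b (γ n) (hγ n) (hM n) s s.2 t t.2
        rwa [abs_sub_comm, ← Real.dist_eq, ← abs_of_nonneg (dist_nonneg (x := (s : ℝ)))] at this
  obtain ⟨g₀, -, ψ, hψ, hlim⟩ := hcomp.tendsto_subseq fun n => subset_closure (mem_range_self n)
  refine ⟨ψ, hψ, fun t => g₀ (projIcc 0 1 zero_le_one t), ?_⟩
  rw [BoundedContinuousFunction.tendsto_iff_tendstoUniformly] at hlim
  rw [Metric.tendstoUniformly_iff] at hlim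
  rw [Metric.tendstoUniformlyOn_iff]
  intro e he
  filter_upwards [hlim e he] with k hk t ht
  simp only [projIcc_of_mem zero_le_one ht]
  exact hk ⟨t, ht⟩

/-- Minimizing sequences subconverge uniformly to minimizers of constant speed. -/
theorem exists_subseq_tendstoUniformlyOn_argmin (hf : IsKernel D p f) (hp : 1 < p)
    (hD : Convex ℝ D) (hDc : IsCompact D) {γ : ℕ → ℝ → EuclideanSpace ℝ (Fin d)}
    (hγ : ∀ n, γ n ∈ lipPaths D a b)
    (hcost : Tendsto (fun n => cost f (γ n)) atTop (𝓝 (gdist p f D a b ^ p))) :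
    ∃ ψ : ℕ → ℕ, StrictMono ψ ∧ ∃ γ₀ ∈ argmin (cost f) (lipPaths D a b),
      (∀ s t, 0 ≤ s → s < t → t ≤ 1 →
        gdist p f D (γ₀ s) (γ₀ t) = gdist p f D a b * (t - s)) ∧
      cost f γ₀ = gdist p f D a b ^ p ∧
      TendstoUniformlyOn (fun k => γ (ψ k)) γ₀ atTop (Icc 0 1) := by
  have hp0 : 0 < p := by linarith
  obtain ⟨M, hM⟩ := hcost.bddAbove_range
  obtain ⟨ψ, hψ, γ₀, hlim⟩ := exists_subseq_tendstoUniformlyOn hf hp hD hDc hγ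
    (fun n => hM (mem_range_self n))
  have hpt : ∀ t ∈ Icc (0 : ℝ) 1, Tendsto (fun k => γ (ψ k) t) atTop (𝓝 (γ₀ t)) :=
    fun t ht => hlim.tendsto_at ht
  have hspeed : ∀ s t, 0 ≤ s → s < t → t ≤ 1 →
      gdist p f D (γ₀ s) (γ₀ t) = gdist p f D a b * (t - s) := fun s t hs hst ht =>
    gdist_eq_of_tendsto hf hp hD hDc.isClosed (fun k => hγ (ψ k))
      (hcost.comp hψ.tendsto_atTop) hpt hs hst ht
  have hmem : MapsTo γ₀ (Icc 0 1) D := fun t ht =>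
    hDc.isClosed.mem_of_tendsto (hpt t ht) (Eventually.of_forall fun k => (hγ (ψ k)).2.1 ht)
  have h0 : γ₀ 0 = a := by
    refine tendsto_nhds_unique (hpt 0 (by simp)) ?_
    simp only [(hγ _).2.2.1, tendsto_const_nhds]
  have h1 : γ₀ 1 = b := by
    refine tendsto_nhds_unique (hpt 1 (by simp)) ?_
    simp only [(hγ _).2.2.2, tendsto_const_nhds]
  have hl : 0 ≤ gdist p f D a b := gdist_nonneg hf
  have hspeed' : ∀ s t, 0 ≤ s → s < t → t ≤ 1 →
      gdist p f D (γ₀ s) (γ₀ t) ≤ gdist p f D a b * (t - s) := fun s t hs hst ht =>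
    (hspeed s t hs hst ht).le
  have hmem₀ : γ₀ ∈ lipPaths D a b :=
    ⟨exists_lipschitzOnWith_of_gdist_le hf hp.le hD hmem hl hspeed', hmem, h0, h1⟩
  have hle := cost_le_of_gdist_le hf hp.le hD hDc hmem₀ hl hspeed'
  exact ⟨ψ, hψ, γ₀, ⟨hmem₀, fun η hη => hle.trans (gdist_rpow_le_cost hf hp0 hη)⟩, hspeed,
    le_antisymm hle (gdist_rpow_le_cost hf hp0 hmem₀), hlim⟩

/-- Any two points are joined by a minimizer of constant speed. -/
theorem exists_geodesic (hf : IsKernel D p f) (hp : 1 < p) (hD : Convex ℝ D) (hDc : IsCompact D)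
    (ha : a ∈ D) (hb : b ∈ D) :
    ∃ γ₀ ∈ lipPaths D a b, cost f γ₀ = gdist p f D a b ^ p ∧
      ∀ s t, 0 ≤ s → s < t → t ≤ 1 →
        gdist p f D (γ₀ s) (γ₀ t) = gdist p f D a b * (t - s) := by
  have hp0 : 0 < p := by linarith
  have hne : (cost f '' lipPaths D a b).Nonempty :=
    ⟨_, mem_image_of_mem _ (lineMap_mem_lipPaths hD ha hb)⟩
  obtain ⟨u, -, hu, hmem⟩ := exists_seq_tendsto_sInf hne ⟨0, zero_mem_lowerBounds_cost hf⟩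
  choose γ hγ hγu using hmem
  rw [← gdist_rpow hf hp0] at hu
  obtain ⟨-, -, γ₀, h, hs, hc, -⟩ := exists_subseq_tendstoUniformlyOn_argmin hf hp hD hDc hγ
    (by simpa only [hγu] using hu)
  exact ⟨γ₀, h.1, hc, hs⟩

end RandomGeodesics

namespace RandomGeodesics

variable {d : ℕ} {D : Set (EuclideanSpace ℝ (Fin d))} {p : ℝ}
  {f : EuclideanSpace ℝ (Fin d) → EuclideanSpace ℝ (Fin d) → ℝ}
  {x y z a b : EuclideanSpace ℝ (Fin d)} {γ η : ℝ → EuclideanSpace ℝ (Fin d)}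
  {m : ℕ} {v w : ℕ → EuclideanSpace ℝ (Fin d)}

/-! ### Polylines -/

lemma exists_index_of_mem_Icc (hm : 0 < m) {t : ℝ} (ht : t ∈ Icc (0 : ℝ) 1) :
    ∃ i < m, t ∈ Icc ((i : ℝ) / m) (((i : ℝ) + 1) / m) := by
  have hm' : (0 : ℝ) < m := by exact_mod_cast hm
  rcases ht.2.eq_or_lt with rfl | h1
  -- At `t = 1` the floor would give the index `m`, which is not an edge.
  · refine ⟨m - 1, by omega, ?_, ?_⟩
    · rw [div_le_one hm']
      exact_mod_cast Nat.sub_le m 1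
    · rw [le_div_iff₀ hm', Nat.cast_sub hm]
      simp
  · have h0 : 0 ≤ m * t := by have := ht.1; positivity
    refine ⟨⌊m * t⌋₊, ?_, ?_, ?_⟩
    · rw [Nat.floor_lt h0]
      nlinarith
    · rw [div_le_iff₀ hm']
      exact (Nat.floor_le h0).trans_eq (mul_comm _ _)
    · rw [le_div_iff₀ hm', mul_comm]
      exact (Nat.lt_floor_add_one _).le

lemma ae_exists_index (hm : 0 < m) : ∀ᵐ t ∂(volume.restrict (Ioo (0 : ℝ) 1)),
    ∃ i < m, t ∈ Ioo ((i : ℝ) / m) (((i : ℝ) + 1) / m) := by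
  have hnull : volume (range fun i : ℕ => (i : ℝ) / m) = 0 := (countable_range _).measure_zero _
  filter_upwards [ae_restrict_mem measurableSet_Ioo,
    ae_restrict_of_ae (measure_eq_zero_iff_ae_notMem.1 hnull)] with t ht hnot
  obtain ⟨i, hi, h⟩ := exists_index_of_mem_Icc hm (Ioo_subset_Icc_self ht)
  refine ⟨i, hi, h.1.lt_of_ne fun he => hnot ⟨i, he⟩, h.2.lt_of_ne fun he => hnot ⟨i + 1, ?_⟩⟩
  rw [he]
  push_cast
  rfl

lemma IsPolyline.deriv_eq (h : IsPolyline m v γ) {i : ℕ} (hi : i < m) {t : ℝ}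
    (ht : t ∈ Ioo ((i : ℝ) / m) (((i : ℝ) + 1) / m)) :
    deriv γ t = (m : ℝ) • (v (i + 1) - v i) := by
  have h1 : γ =ᶠ[𝓝 t] fun t => (1 - ((m : ℝ) * t - i)) • v i + ((m : ℝ) * t - i) • v (i + 1) := by
    filter_upwards [Icc_mem_nhds ht.1 ht.2] with s hs using h i hi s hs
  rw [h1.deriv_eq]
  have h2 : HasDerivAt (fun t : ℝ => (m : ℝ) * t - i) m t := by
    simpa using ((hasDerivAt_id t).const_mul (m : ℝ)).sub_const (i : ℝ)
  have h3 := ((h2.const_sub 1).smul_const (v i)).add (h2.smul_const (v (i + 1)))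
  refine h3.deriv.trans ?_
  rw [smul_sub, neg_smul]
  abel

lemma mul_sub_mem_Icc (hm : 0 < m) {i : ℕ} {t : ℝ}
    (ht : t ∈ Icc ((i : ℝ) / m) (((i : ℝ) + 1) / m)) : (m : ℝ) * t - i ∈ Icc (0 : ℝ) 1 := by
  have hm' : (0 : ℝ) < m := by exact_mod_cast hm
  have h1 := ht.1
  have h2 := ht.2
  rw [div_le_iff₀ hm'] at h1
  rw [le_div_iff₀ hm'] at h2
  constructor <;> linarith

lemma IsPolyline.norm_sub_le (h : IsPolyline m v γ) {i : ℕ} (hi : i < m) {t : ℝ}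
    (ht : t ∈ Icc ((i : ℝ) / m) (((i : ℝ) + 1) / m)) :
    ‖γ t - v i‖ ≤ ‖v (i + 1) - v i‖ := by
  have hmem := mul_sub_mem_Icc (by omega) ht
  have e : γ t - v i = ((m : ℝ) * t - i) • (v (i + 1) - v i) := by
    rw [h i hi t ht]
    module
  rw [e, norm_smul, Real.norm_of_nonneg hmem.1]
  exact mul_le_of_le_one_left (norm_nonneg _) hmem.2

lemma IsPolyline.mapsTo (h : IsPolyline m v γ) (hm : 0 < m) (hD : Convex ℝ D)
    (hv : ∀ i ≤ m, v i ∈ D) : MapsTo γ (Icc 0 1) D := by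
  intro t ht
  obtain ⟨i, hi, hti⟩ := exists_index_of_mem_Icc hm ht
  have hmem := mul_sub_mem_Icc hm hti
  rw [h i hi t hti]
  exact hD (hv i hi.le) (hv (i + 1) hi) (by linarith [hmem.2]) hmem.1 (by ring)

lemma IsPolyline.exists_lipschitzOnWith (h : IsPolyline m v γ) (hm : 0 < m) :
    ∃ K, LipschitzOnWith K γ (Icc 0 1) := by
  have hm' : (0 : ℝ) < m := by exact_mod_cast hm
  set B : NNReal := ∑ i ∈ Finset.range m, ‖v (i + 1) - v i‖₊ with hB
  have hpiece : ∀ i < m, LipschitzOnWith (m * B) γ (Icc ((i : ℝ) / m) (((i : ℝ) + 1) / m)) := by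
    intro i hi
    rw [lipschitzOnWith_iff_dist_le_mul]
    intro s hs t ht
    have e : γ s - γ t = ((m : ℝ) * (s - t)) • (v (i + 1) - v i) := by
      rw [h i hi s hs, h i hi t ht]
      module
    have hle : ‖v (i + 1) - v i‖₊ ≤ B :=
      Finset.single_le_sum (f := fun i => ‖v (i + 1) - v i‖₊) (fun _ _ => zero_le)
        (Finset.mem_range.2 hi)
    have hle' : ‖v (i + 1) - v i‖ ≤ B := by exact_mod_cast hle
    rw [dist_eq_norm, e, norm_smul, norm_mul, Real.norm_of_nonneg hm'.le, ← dist_eq_norm]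
    push_cast
    rw [mul_right_comm]
    gcongr
  have key : ∀ k ≤ m, LipschitzOnWith (m * B) γ (Icc 0 ((k : ℝ) / m)) := by
    intro k
    induction k with
    | zero => intro _; simp [lipschitzOnWith_iff_dist_le_mul]
    | succ k ih =>
      intro hk
      push_cast
      exact lipschitzOnWith_Icc_trans (ih (by omega)) (hpiece k (by omega))
  exact ⟨_, by simpa [hm'.ne'] using key m le_rfl⟩

lemma IsPolyline.apply_zero (h : IsPolyline m v γ) (hm : 0 < m) : γ 0 = v 0 := by
  have := h 0 hm 0 ⟨by simp, by positivity⟩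
  simpa using this

lemma IsPolyline.apply_one (h : IsPolyline m v γ) (hm : 0 < m) : γ 1 = v m := by
  have hm' : (0 : ℝ) < m := by exact_mod_cast hm
  obtain ⟨k, rfl⟩ : ∃ k, m = k + 1 := ⟨m - 1, by omega⟩
  push_cast at hm'
  have := h k (by omega) 1 ⟨by push_cast; rw [div_le_one hm']; linarith,
    by push_cast; rw [div_self hm'.ne']⟩
  simpa using this

lemma IsPolyline.mem_lipPaths (h : IsPolyline m v γ) (hm : 0 < m) (hD : Convex ℝ D)
    (hv : ∀ i ≤ m, v i ∈ D) (ha : v 0 = a) (hb : v m = b) : γ ∈ lipPaths D a b :=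
  ⟨h.exists_lipschitzOnWith hm, h.mapsTo hm hD hv, (h.apply_zero hm).trans ha,
    (h.apply_one hm).trans hb⟩

lemma polyPaths_subset_lipPaths {x : ℕ → EuclideanSpace ℝ (Fin d)} {n : ℕ} {ε : ℝ}
    (hD : Convex ℝ D) (hV : vertices x n a b ⊆ D) : polyPaths x n ε a b ⊆ lipPaths D a b := by
  rintro γ ⟨m, v, hv, hγ⟩
  exact hγ.mem_lipPaths hv.steps_pos hD (fun i hi => hV (hv.mem i hi)) hv.start hv.finish

/-- The polyline through `v 0, v 1, …` that takes time `1 / m` on each edge. -/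
noncomputable def polyline (m : ℕ) (v : ℕ → EuclideanSpace ℝ (Fin d)) :
    ℝ → EuclideanSpace ℝ (Fin d) :=
  fun t => (1 - ((m : ℝ) * t - ⌊(m : ℝ) * t⌋₊)) • v ⌊(m : ℝ) * t⌋₊ +
    ((m : ℝ) * t - ⌊(m : ℝ) * t⌋₊) • v (⌊(m : ℝ) * t⌋₊ + 1)

lemma isPolyline_polyline (m : ℕ) (v : ℕ → EuclideanSpace ℝ (Fin d)) :
    IsPolyline m v (polyline m v) := by
  intro i hi t ht
  have hmem := mul_sub_mem_Icc (by omega) ht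
  rcases hmem.2.eq_or_lt with h1 | h1
  -- At the right end of an edge the floor has already jumped to `i + 1`; both formulas give `v (i +
  -- 1)` there.
  · have e : (m : ℝ) * t = ((i + 1 : ℕ) : ℝ) := by push_cast; linarith
    simp only [polyline]
    rw [e, Nat.floor_natCast]
    simp
  · have e : ⌊(m : ℝ) * t⌋₊ = i := by
      rw [Nat.floor_eq_iff (by have := hmem.1; have : (0 : ℝ) ≤ i := by positivity
                               linarith)]
      constructor <;> linarith [hmem.1]
    simp only [polyline, e]

lemma IsPolyline.eqOn (h : IsPolyline m v γ) (h' : IsPolyline m w η) (hm : 0 < m)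
    (hvw : ∀ i ≤ m, v i = w i) : EqOn γ η (Icc 0 1) := by
  intro t ht
  obtain ⟨i, hi, hti⟩ := exists_index_of_mem_Icc hm ht
  rw [h i hi t hti, h' i hi t hti, hvw i hi.le, hvw (i + 1) hi]

/-! ### Minimizers over the graph paths -/

lemma _root_.Set.Finite.exists_pos_le_norm_sub {E : Type*} [NormedAddCommGroup E] {V : Set E}
    (hV : V.Finite) : ∃ δ > 0, ∀ u ∈ V, ∀ w ∈ V, 0 < ‖u - w‖ → δ ≤ ‖u - w‖ := by
  set S : Set ℝ := (fun q : E × E => ‖q.1 - q.2‖) '' (V ×ˢ V) \ {0} with hS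
  have hfin : S.Finite := ((hV.prod hV).image _).sdiff
  have h0 : Sᶜ ∈ 𝓝 (0 : ℝ) := hfin.isClosed.isOpen_compl.mem_nhds (by simp [hS])
  obtain ⟨δ, hδ, hball⟩ := Metric.mem_nhds_iff.1 h0
  refine ⟨δ, hδ, fun u hu w hw hpos => ?_⟩
  by_contra! hlt
  refine hball (by simpa using hlt : ‖u - w‖ ∈ Metric.ball 0 δ) ⟨⟨(u, w), ⟨hu, hw⟩, rfl⟩, ?_⟩
  exact hpos.ne'

lemma vertices_finite (x : ℕ → EuclideanSpace ℝ (Fin d)) (n : ℕ) : (vertices x n a b).Finite :=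
  ((finite_Iio n).image x).union (toFinite _)

/-- Among the graph paths of bounded cost only finitely many values of the cost occur. -/
lemma finite_cost_le {x : ℕ → EuclideanSpace ℝ (Fin d)} {n : ℕ} {ε : ℝ} (hf : IsKernel D p f)
    (hp : 0 < p) (hD : Convex ℝ D) (hV : vertices x n a b ⊆ D) (M : ℝ) :
    (cost f '' {γ ∈ polyPaths x n ε a b | cost f γ ≤ M}).Finite := by
  set V := vertices x n a b with hVdef
  have hVfin : V.Finite := vertices_finite x n
  have : Finite V := hVfin
  obtain ⟨m₁, m₂, h1, h2, h⟩ := hf.elliptic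
  obtain ⟨δ, hδ, hsep⟩ := hVfin.exists_pos_le_norm_sub
  -- Edges have length at least `δ` and are traversed in time `1 / m`, so the speed is at least `m *
  -- δ`. A cost bound therefore limits the number of steps.
  have hlow : ∀ γ m v, IsGraphPath V ε a b m v → IsPolyline m v γ →
      m₁ * (m * δ) ^ p ≤ cost f γ := by
    intro γ m v hv hγ
    have hmem : γ ∈ lipPaths D a b :=
      hγ.mem_lipPaths hv.steps_pos hD (fun i hi => hV (hv.mem i hi)) hv.start hv.finish
    refine le_cost_of_ae_le hf hp.le hmem ?_
    filter_upwards [ae_restrict_mem measurableSet_Ioo, ae_exists_index hv.steps_pos]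
      with t ht ⟨i, hi, hti⟩
    refine le_trans ?_ (h _ (hmem.2.1 (Ioo_subset_Icc_self ht)) _).1
    rw [hγ.deriv_eq hi hti, norm_smul, Real.norm_natCast, norm_sub_rev]
    gcongr
    exact hsep _ (hv.mem i hi.le) _ (hv.mem _ hi) (hv.adj i hi).1
  set N := ⌈(M / m₁) ^ p⁻¹ / δ⌉₊ with hN
  -- The cost depends only on `v 0, …, v m`; the default `a` beyond has no influence on `[0,1]`.
  let g : (m : ℕ) → (Fin (m + 1) → V) → ℝ := fun m q =>
    cost f (polyline m fun i => if hi : i < m + 1 then (q ⟨i, hi⟩ : EuclideanSpace ℝ (Fin d)) else a)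
  have hfin : (⋃ m ∈ Iic N, range (g m)).Finite :=
    (finite_Iic N).biUnion fun m _ => finite_range _
  refine hfin.subset ?_
  rintro _ ⟨γ, ⟨⟨m, v, hv, hγ⟩, hM⟩, rfl⟩
  have hmN : m ≤ N := by
    have e1 := (hlow γ m v hv hγ).trans hM
    rw [← le_div_iff₀' h1] at e1
    have e2 := Real.rpow_le_rpow (by positivity) e1 (inv_nonneg.2 hp.le)
    rw [Real.rpow_rpow_inv (by positivity) hp.ne', ← le_div_iff₀ hδ] at e2
    exact_mod_cast e2.trans (Nat.le_ceil _)
  refine mem_biUnion (show m ∈ Iic N from hmN) ⟨fun i => ⟨v i, hv.mem i (by omega)⟩, ?_⟩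
  refine cost_congr (IsPolyline.eqOn (isPolyline_polyline _ _) hγ hv.steps_pos fun i hi => ?_)
  simp [Nat.lt_succ_iff.2 hi]

lemma exists_isLeast_cost_polyPaths {x : ℕ → EuclideanSpace ℝ (Fin d)} {n : ℕ} {ε : ℝ}
    (hf : IsKernel D p f) (hp : 0 < p) (hD : Convex ℝ D) (hV : vertices x n a b ⊆ D)
    (hne : (polyPaths x n ε a b).Nonempty) :
    ∃ L, IsLeast (cost f '' polyPaths x n ε a b) L := by
  obtain ⟨γ₁, hγ₁⟩ := hne
  obtain ⟨_, ⟨γ, ⟨hγ, hγM⟩, rfl⟩, hmin⟩ := exists_min_image _ id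
    (finite_cost_le hf hp hD hV (cost f γ₁)) ⟨_, mem_image_of_mem _ ⟨hγ₁, le_rfl⟩⟩
  refine ⟨cost f γ, mem_image_of_mem _ hγ, ?_⟩
  rintro _ ⟨η, hη, rfl⟩
  rcases le_total (cost f η) (cost f γ₁) with hle | hle
  · exact hmin _ (mem_image_of_mem _ ⟨hη, hle⟩)
  · exact hγM.trans hle

/-! ### Recovery sequences -/

/-- In a set with two distant points, a `ρ`-dense sample of `D` has points close to any given point
of `D` that avoid two prescribed points. -/
lemma exists_sample_ne (hD : Convex ℝ D) {x₀ y₀ : EuclideanSpace ℝ (Fin d)} (hx₀ : x₀ ∈ D)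
    (hy₀ : y₀ ∈ D) {ρ : ℝ} (hρ : 0 < ρ) (hR : 12 * ρ ≤ ‖x₀ - y₀‖)
    {S : Set (EuclideanSpace ℝ (Fin d))} (hS : ∀ z ∈ D, ∃ w ∈ S, ‖w - z‖ ≤ ρ) (hz : z ∈ D)
    (u₁ u₂ : EuclideanSpace ℝ (Fin d)) : ∃ w ∈ S, w ≠ u₁ ∧ w ≠ u₂ ∧ ‖w - z‖ ≤ 7 * ρ := by
  obtain ⟨z₀, hz₀, hfar⟩ : ∃ z₀ ∈ D, 6 * ρ ≤ ‖z₀ - z‖ := by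
    by_contra! hcon
    have h1 := hcon _ hx₀
    have h2 := hcon _ hy₀
    have h3 := norm_sub_le_norm_sub_add_norm_sub x₀ z y₀
    rw [norm_sub_rev z y₀] at h3
    linarith
  have hpos : 0 < ‖z₀ - z‖ := by linarith
  -- The points `q 0`, `q 1`, `q 2` are `3 * ρ` apart, so sample points within `ρ` of them are
  -- distinct and one of the three avoids both `u₁` and `u₂`. The farthest is within `6 * ρ + ρ` of
  -- `z`.
  set q : ℝ → EuclideanSpace ℝ (Fin d) := fun k => z + (3 * k * ρ / ‖z₀ - z‖) • (z₀ - z) with hq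
  have hqD : ∀ k, 0 ≤ k → k ≤ 2 → q k ∈ D := by
    intro k hk0 hk2
    refine hD.add_smul_sub_mem hz hz₀ ⟨by positivity, (div_le_one hpos).2 ?_⟩
    nlinarith
  have hqd : ∀ k j, ‖q k - q j‖ = 3 * ρ * |k - j| := by
    intro k j
    have e : q k - q j = (3 * ρ * (k - j) / ‖z₀ - z‖) • (z₀ - z) := by
      simp only [hq]
      module
    rw [e, norm_smul, norm_div, norm_norm, div_mul_cancel₀ _ hpos.ne', norm_mul,
      Real.norm_of_nonneg (by positivity), Real.norm_eq_abs]
  obtain ⟨w₀, hw₀, d₀⟩ := hS _ (hqD 0 (by norm_num) (by norm_num))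
  obtain ⟨w₁, hw₁, d₁⟩ := hS _ (hqD 1 (by norm_num) (by norm_num))
  obtain ⟨w₂, hw₂, d₂⟩ := hS _ (hqD 2 (by norm_num) (by norm_num))
  have hne : ∀ {k j w w'}, 1 ≤ |k - j| → ‖w - q k‖ ≤ ρ → ‖w' - q j‖ ≤ ρ → w ≠ w' := by
    rintro k j w w' hkj h1 h2 rfl
    have h3 := norm_sub_le_norm_sub_add_norm_sub (q k) w (q j)
    rw [hqd, norm_sub_rev (q k)] at h3
    nlinarith
  have n01 : w₀ ≠ w₁ := hne (by norm_num) d₀ d₁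
  have n02 : w₀ ≠ w₂ := hne (by norm_num) d₀ d₂
  have n12 : w₁ ≠ w₂ := hne (by norm_num) d₁ d₂
  have hq0 : q 0 = z := by simp [hq]
  have hclose : ∀ {k w}, |k| ≤ 2 → ‖w - q k‖ ≤ ρ → ‖w - z‖ ≤ 7 * ρ := by
    intro k w hk hw
    have h1 := norm_sub_le_norm_sub_add_norm_sub w (q k) z
    have h2 := hqd k 0
    rw [hq0, sub_zero] at h2
    nlinarith
  have c₀ := hclose (by norm_num) d₀
  have c₁ := hclose (by norm_num) d₁
  have c₂ := hclose (by norm_num) d₂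
  by_cases e0 : w₀ = u₁ ∨ w₀ = u₂
  · by_cases e1 : w₁ = u₁ ∨ w₁ = u₂
    · refine ⟨w₂, hw₂, ?_, ?_, c₂⟩ <;> grind
    · exact ⟨w₁, hw₁, fun h => e1 (Or.inl h), fun h => e1 (Or.inr h), c₁⟩
  · exact ⟨w₀, hw₀, fun h => e0 (Or.inl h), fun h => e0 (Or.inr h), c₀⟩

/-- A graph path following prescribed points `c 0 = a, …, c m = b`. -/
lemma exists_isGraphPath_near {x : ℕ → EuclideanSpace ℝ (Fin d)} {n : ℕ} {ε σ : ℝ}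
    (hm : 2 ≤ m) {c : ℕ → EuclideanSpace ℝ (Fin d)} (hσ : 0 ≤ σ) (hca : c 0 = a) (hcb : c m = b)
    (hS : ∀ i u₁ u₂, ∃ w ∈ x '' Iio n, w ≠ u₁ ∧ w ≠ u₂ ∧ ‖w - c i‖ ≤ σ)
    (hstep : ∀ i < m, ‖c i - c (i + 1)‖ + 2 * σ < ε) :
    ∃ v, IsGraphPath (vertices x n a b) ε a b m v ∧ ∀ i ≤ m, ‖v i - c i‖ ≤ σ := by
  choose g hgS hg1 hg2 hgc using hS
  -- Each new vertex avoids its predecessor and `b`, so that no edge, including the last one, is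
  -- degenerate.
  let u : ℕ → EuclideanSpace ℝ (Fin d) := fun i => Nat.rec a (fun i prev => g (i + 1) prev b) i
  have hu : ∀ i, u (i + 1) = g (i + 1) (u i) b := fun i => rfl
  set v : ℕ → EuclideanSpace ℝ (Fin d) := fun i => if i < m then u i else b with hv
  have hnear : ∀ i ≤ m, ‖v i - c i‖ ≤ σ := by
    intro i hi
    rcases hi.eq_or_lt with rfl | hi
    · simpa [hv, hcb] using hσ
    · simp only [hv, hi, if_true]
      cases i with
      | zero => simpa [u, hca] using hσ
      | succ i => rw [hu]; exact hgc _ _ _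
  refine ⟨v, ⟨by omega, by simp [hv, u, show 0 < m by omega], by simp [hv], ?_, ?_⟩, hnear⟩
  · intro i hi
    rcases hi.eq_or_lt with rfl | hi
    · simp [hv, vertices]
    · simp only [hv, hi, if_true]
      cases i with
      | zero => simp [u, vertices]
      | succ i => rw [hu]; exact Or.inl (hgS _ _ _)
  · intro i hi
    refine ⟨norm_pos_iff.2 (sub_ne_zero.2 ?_), ?_⟩
    · simp only [hv, hi, if_true]
      split_ifs with h
      · rw [hu]; exact (hg1 _ _ _).symm
      -- As `m ≥ 2`, the last edge starts at a chosen sample point and not at `a`, which may equal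
      -- `b`.
      · obtain ⟨j, rfl⟩ : ∃ j, i = j + 1 := ⟨i - 1, by omega⟩
        rw [hu]; exact hg2 _ _ _
    · have h1 := hnear i hi.le
      have h2 := hnear (i + 1) hi
      have h3 := hstep i hi
      rw [norm_sub_rev] at h2
      have h4 := norm_sub_le_norm_sub_add_norm_sub (v i) (c i) (v (i + 1))
      have h5 := norm_sub_le_norm_sub_add_norm_sub (c i) (c (i + 1)) (v (i + 1))
      linarith

/-- Sufficiently dense samples admit graph paths of almost minimal cost. -/
theorem exists_polyPath_cost_le (hf : IsKernel D p f) (hp : 1 < p) (hD : Convex ℝ D)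
    (hDc : IsCompact D) (hnt : D.Nontrivial) (ha : a ∈ D) (hb : b ∈ D) {κ : ℝ} (hκ : 0 < κ) :
    ∃ δ > 0, ∃ e₀ > 0, ∀ (x : ℕ → EuclideanSpace ℝ (Fin d)) (n : ℕ) (ε : ℝ), 0 < ε → ε < e₀ →
      vertices x n a b ⊆ D → (∀ z ∈ D, ∃ i < n, ‖x i - z‖ ≤ δ * ε) →
      ∃ γ ∈ polyPaths x n ε a b, cost f γ ≤ gdist p f D a b ^ p + κ := by
  have hp0 : 0 < p := by linarith
  obtain ⟨x₀, hx₀, y₀, hy₀, hxy₀⟩ := hnt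
  have hR : 0 < ‖x₀ - y₀‖ := norm_pos_iff.2 (sub_ne_zero.2 hxy₀)
  obtain ⟨γ₀, hγ₀, -, hspeed⟩ := exists_geodesic hf hp hD hDc ha hb
  obtain ⟨K, hK⟩ := hγ₀.1
  set l := gdist p f D a b with hl
  have hl0 : 0 ≤ l := gdist_nonneg hf
  have hlp : 0 ≤ l ^ p := Real.rpow_nonneg hl0 p
  obtain ⟨r, hr, hloc⟩ := exists_le_gdist_rpow hf hp.le hD hDc
    (κ := κ / (2 * (l ^ p + 1))) (by positivity)
  have hu := (hDc.prod (isCompact_closedBall (0 : EuclideanSpace ℝ (Fin d))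
    (K + 1))).uniformContinuousOn_of_continuous
      (hf.continuousOn.mono (prod_mono_right (subset_univ _)))
  obtain ⟨τ, hτ, hunif⟩ := Metric.uniformContinuousOn_iff.1 hu (κ / 2) (half_pos hκ)
  have hK0 : (0 : ℝ) ≤ K := K.2
  -- The bound `1 / 8` keeps perturbed steps shorter than `ε`; the other bound keeps the velocity
  -- error, at most `2 * σ₀ * (m * ε)`, below `min τ 1`.
  set σ₀ : ℝ := min (1 / 8) (min τ 1 / (4 * (2 * K + 3))) with hσ₀
  have hτ1 : 0 < min τ 1 := lt_min hτ one_pos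
  have hσ₀pos : 0 < σ₀ := lt_min (by norm_num) (by positivity)
  have hσ₁ : σ₀ ≤ 1 / 8 := min_le_left _ _
  have hσ₂ : 2 * σ₀ * (2 * K + 3) < min τ 1 := by
    have h3 : σ₀ ≤ min τ 1 / (4 * (2 * K + 3)) := min_le_right _ _
    rw [le_div_iff₀ (by positivity)] at h3
    linarith
  -- The factor `7` is what `exists_sample_ne` loses in avoiding two points.
  refine ⟨σ₀ / 7, by positivity, min (min 1 r) (min (τ / 2) ‖x₀ - y₀‖), by positivity,
    fun x n ε hε hεlt hV hcover => ?_⟩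
  obtain ⟨⟨hε1, hεr⟩, hετ, hεR⟩ : (ε < 1 ∧ ε < r) ∧ ε < τ / 2 ∧ ε < ‖x₀ - y₀‖ := by
    simpa only [lt_min_iff] using hεlt
  -- Enough steps for the geodesic to move less than `ε / 2` in each, yet `m * ε` stays bounded, so
  -- displacing vertices by `σ₀ * ε` changes velocities by a multiple of `σ₀`.
  set m := ⌈2 * (K + 1) / ε⌉₊ with hmdef
  have hm1 : 2 * (K + 1) / ε ≤ (m : ℝ) := Nat.le_ceil _
  have hm2 : (m : ℝ) < 2 * (K + 1) / ε + 1 := Nat.ceil_lt_add_one (by positivity)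
  have hmε : 2 * (K + 1) ≤ m * ε := (div_le_iff₀ hε).1 hm1
  have hmε' : m * ε ≤ 2 * K + 3 := by
    have := mul_lt_mul_of_pos_right hm2 hε
    rw [add_mul, div_mul_cancel₀ _ hε.ne'] at this
    linarith
  have hm : 2 ≤ m := by
    have : (2 : ℝ) ≤ m := by nlinarith
    exact_mod_cast this
  have hm' : (0 : ℝ) < m := by positivity
  set c : ℕ → EuclideanSpace ℝ (Fin d) := fun i => γ₀ (min ((i : ℝ) / m) 1) with hc
  have hcmem : ∀ i : ℕ, min ((i : ℝ) / m) 1 ∈ Icc (0 : ℝ) 1 := fun i =>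
    ⟨le_min (by positivity) zero_le_one, min_le_right _ _⟩
  have hcD : ∀ i, c i ∈ D := fun i => hγ₀.2.1 (hcmem i)
  have hle1 : ∀ i ≤ m, (i : ℝ) / m ≤ 1 := fun i hi => (div_le_one hm').2 (by exact_mod_cast hi)
  have hceq : ∀ i ≤ m, c i = γ₀ ((i : ℝ) / m) := fun i hi => by
    simp only [hc, min_eq_left (hle1 i hi)]
  have hcstep : ∀ i < m, ‖c (i + 1) - c i‖ ≤ K / m := by
    intro i hi
    rw [hceq i hi.le, hceq (i + 1) hi, ← dist_eq_norm]
    refine (hK.dist_le_mul _ ⟨by positivity, hle1 _ hi⟩ _ ⟨by positivity, hle1 _ hi.le⟩).trans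
      (le_of_eq ?_)
    rw [Real.dist_eq, ← sub_div, Nat.cast_succ, add_sub_cancel_left, abs_of_pos (by positivity),
      mul_one_div]
  have hKm : K / m < ε / 2 := by
    rw [div_lt_iff₀ hm']
    nlinarith
  have hdense : ∀ z ∈ D, ∃ w ∈ x '' Iio n, ‖w - z‖ ≤ σ₀ / 7 * ε := fun z hz => by
    obtain ⟨i, hi, h⟩ := hcover z hz
    exact ⟨x i, ⟨i, hi, rfl⟩, h⟩
  have hσR : 12 * (σ₀ / 7 * ε) ≤ ‖x₀ - y₀‖ := by nlinarith
  obtain ⟨v, hv, hvc⟩ := exists_isGraphPath_near (σ := σ₀ * ε) (a := a) (b := b) (c := c)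
    (x := x) (n := n) (ε := ε) hm (by positivity)
    (by simp [hc, hγ₀.2.2.1]) (by rw [hceq m le_rfl, div_self hm'.ne', hγ₀.2.2.2])
    (fun i u₁ u₂ => by
      obtain ⟨w, h1, h2, h3, h4⟩ := exists_sample_ne hD hx₀ hy₀ (ρ := σ₀ / 7 * ε) (by positivity)
        hσR hdense (hcD i) u₁ u₂
      exact ⟨w, h1, h2, h3, by linarith⟩)
    (fun i hi => by
      rw [norm_sub_rev]
      have := hcstep i hi
      nlinarith)
  have hpoly := isPolyline_polyline m v
  have hmem : polyline m v ∈ lipPaths D a b :=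
    hpoly.mem_lipPaths hv.steps_pos hD (fun i hi => hV (hv.mem i hi)) hv.start hv.finish
  refine ⟨polyline m v, ⟨m, v, hv, hpoly⟩, cost_le_of_ae_le hf hp0.le hmem ?_⟩
  filter_upwards [ae_restrict_mem measurableSet_Ioo, ae_exists_index hv.steps_pos]
    with t ht ⟨i, hi, hti⟩
  rw [hpoly.deriv_eq hi hti]
  have hbase : dist (polyline m v t) (c i) < τ := by
    have h1 := hpoly.norm_sub_le hi (Ioo_subset_Icc_self hti)
    have h2 := (hv.adj i hi).2
    have h3 := hvc i hi.le
    have h4 := norm_sub_le_norm_sub_add_norm_sub (polyline m v t) (v i) (c i)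
    rw [norm_sub_rev] at h2
    rw [dist_eq_norm]
    nlinarith
  have hvel : dist ((m : ℝ) • (v (i + 1) - v i)) ((m : ℝ) • (c (i + 1) - c i)) < min τ 1 := by
    have h1 := hvc i hi.le
    have h2 := hvc (i + 1) hi
    have h3 : ‖(v (i + 1) - v i) - (c (i + 1) - c i)‖ ≤ 2 * (σ₀ * ε) := by
      rw [show (v (i + 1) - v i) - (c (i + 1) - c i) = (v (i + 1) - c (i + 1)) - (v i - c i) by abel]
      exact (norm_sub_le _ _).trans (by linarith)
    rw [dist_eq_norm, ← smul_sub, norm_smul, Real.norm_natCast]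
    calc (m : ℝ) * ‖(v (i + 1) - v i) - (c (i + 1) - c i)‖ ≤ m * (2 * (σ₀ * ε)) := by gcongr
      _ = 2 * σ₀ * (m * ε) := by ring
      _ ≤ 2 * σ₀ * (2 * K + 3) := by gcongr
      _ < _ := hσ₂
  have hcv : ‖(m : ℝ) • (c (i + 1) - c i)‖ ≤ K := by
    rw [norm_smul, Real.norm_natCast, ← le_div_iff₀' hm']
    exact hcstep i hi
  have hvv : ‖(m : ℝ) • (v (i + 1) - v i)‖ ≤ K + 1 := by
    have h1 := norm_le_norm_add_norm_sub' ((m : ℝ) • (v (i + 1) - v i))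
      ((m : ℝ) • (c (i + 1) - c i))
    rw [← dist_eq_norm] at h1
    linarith [hvel.trans_le (min_le_right τ 1)]
  have hcont := hunif (polyline m v t, (m : ℝ) • (v (i + 1) - v i))
    ⟨hmem.2.1 (Ioo_subset_Icc_self ht), by simpa using hvv⟩
    (c i, (m : ℝ) • (c (i + 1) - c i)) ⟨hcD i, by simpa using hcv.trans (by linarith)⟩
    (by rw [Prod.dist_eq]; exact max_lt hbase (hvel.trans_le (min_le_left _ _)))
  rw [Real.dist_eq] at hcont
  -- Constant speed enters here: consecutive points are at `gdist` exactly `l / m`, so the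
  -- small-scale comparison bounds the integrand on each step, not only on average.
  have hgeo : f (c i) ((m : ℝ) • (c (i + 1) - c i)) ≤ l ^ p + κ / 2 := by
    have h1 := hloc (c i) (hcD i) (c (i + 1)) (hcD _) (by linarith [hcstep i hi])
    have h2 : gdist p f D (c i) (c (i + 1)) = l / m := by
      rw [hceq i hi.le, hceq (i + 1) hi, hspeed _ _ (by positivity)
        (by gcongr; linarith) (hle1 _ hi), ← sub_div, Nat.cast_succ,
        add_sub_cancel_left, mul_one_div]
    rw [h2, Real.div_rpow hl0 hm'.le] at h1
    rw [hf.homogeneous _ (hcD i) _ _ hm']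
    calc _ ≤ (m : ℝ) ^ p * ((1 + κ / (2 * (l ^ p + 1))) * (l ^ p / m ^ p)) := by gcongr
      _ = l ^ p + κ / 2 * (l ^ p / (l ^ p + 1)) := by
        have := (Real.rpow_pos_of_pos hm' p).ne'
        field_simp
      _ ≤ l ^ p + κ / 2 * 1 := by
        gcongr
        exact (div_le_one (by positivity)).2 (by linarith)
      _ = _ := by ring
  linarith [(abs_lt.1 hcont).2]

end RandomGeodesics

namespace RandomGeodesics

variable {d : ℕ} {D : Set (EuclideanSpace ℝ (Fin d))}

/-! ### Random samples are dense at the scale `ε` -/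

section Sample

variable {E : Type*} [PseudoMetricSpace E] [MeasurableSpace E] [OpensMeasurableSpace E]
  {μ : Measure E} [IsProbabilityMeasure μ] {S : Set E} {c r₀ : ℝ}

/-- A maximal `r`-separated set is an `r`-net, and the disjoint balls of radius `r / 2` around its
points have total mass at most `1`. -/
lemma exists_finset_cover (hc : 0 < c)
    (hball : ∀ z ∈ S, ∀ r, 0 < r → r ≤ r₀ → c * r ^ d ≤ μ.real (Metric.ball z r)) {r : ℝ}
    (hr : 0 < r) (hr₀ : r ≤ r₀) :
    ∃ F : Finset E, ↑F ⊆ S ∧ (∀ z ∈ S, ∃ w ∈ F, dist z w < r) ∧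
      F.card * (c * (r / 2) ^ d) ≤ 1 := by
  classical
  let T : Set ℕ := {k | ∃ F : Finset E, ↑F ⊆ S ∧
    (F : Set E).Pairwise (fun u w => r ≤ dist u w) ∧ F.card = k}
  have hcard : ∀ F : Finset E, ↑F ⊆ S → (F : Set E).Pairwise (fun u w => r ≤ dist u w) →
      F.card * (c * (r / 2) ^ d) ≤ 1 := by
    intro F hF hsep
    have hdisj : (F : Set E).PairwiseDisjoint fun w => Metric.ball w (r / 2) := fun u hu w hw huw =>
      Metric.ball_disjoint_ball (by linarith [hsep hu hw huw])
    calc (F.card : ℝ) * (c * (r / 2) ^ d) = ∑ _w ∈ F, c * (r / 2) ^ d := by simp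
      _ ≤ ∑ w ∈ F, μ.real (Metric.ball w (r / 2)) :=
        Finset.sum_le_sum fun w hw => hball w (hF hw) _ (by linarith) (by linarith)
      _ = μ.real (⋃ w ∈ F, Metric.ball w (r / 2)) :=
        (measureReal_biUnion_finset hdisj fun w _ => Metric.isOpen_ball.measurableSet).symm
      _ ≤ 1 := measureReal_le_one
  have hT : T.Nonempty := ⟨0, ∅, by simp, by simp, rfl⟩
  have hbdd : BddAbove T := by
    refine ⟨⌈1 / (c * (r / 2) ^ d)⌉₊, ?_⟩
    rintro _ ⟨F, hF, hsep, rfl⟩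
    have := hcard F hF hsep
    rw [← le_div_iff₀ (by positivity)] at this
    exact_mod_cast this.trans (Nat.le_ceil _)
  obtain ⟨F, hF, hsep, hmax⟩ := Nat.sSup_mem hT hbdd
  refine ⟨F, hF, fun z hz => ?_, hcard F hF hsep⟩
  by_contra! hfar
  have hzF : z ∉ F := fun h => by
    have := hfar z h
    rw [dist_self] at this
    linarith
  have hmem : F.card + 1 ∈ T := by
    refine ⟨insert z F, ?_, ?_, Finset.card_insert_of_notMem hzF⟩
    · rw [Finset.coe_insert]
      exact insert_subset hz hF
    · rw [Finset.coe_insert]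
      refine hsep.insert fun w hw _ => ⟨hfar w hw, ?_⟩
      rw [dist_comm]
      exact hfar w hw
  have := le_csSup hbdd hmem
  omega

variable {Ω : Type*} [MeasurableSpace Ω] {P : Measure Ω} [IsProbabilityMeasure P]
  {X : ℕ → Ω → E}

/-- The probability that `n` sample points leave a ball of radius `2 * r` empty. -/
lemma measure_exists_empty_ball_le (hX : ∀ i, Measurable (X i)) (hind : iIndepFun X P)
    (hlaw : ∀ i, P.map (X i) = μ) (hc : 0 < c)
    (hball : ∀ z ∈ S, ∀ r, 0 < r → r ≤ r₀ → c * r ^ d ≤ μ.real (Metric.ball z r)) {r : ℝ}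
    (hr : 0 < r) (hr₀ : r ≤ r₀) (n : ℕ) :
    P {ω | ∃ z ∈ S, ∀ i < n, 2 * r < dist (X i ω) z} ≤
      ENNReal.ofReal (Real.exp (-(c * r ^ d * n)) / (c * (r / 2) ^ d)) := by
  obtain ⟨F, hF, hcov, hcard⟩ := exists_finset_cover hc hball hr hr₀
  -- An empty ball of radius `2 * r` contains the ball of radius `r` around some net point, so
  -- finitely many events suffice.
  have hsub : {ω | ∃ z ∈ S, ∀ i < n, 2 * r < dist (X i ω) z} ⊆
      ⋃ w ∈ F, ⋂ i ∈ Finset.range n, X i ⁻¹' (Metric.ball w r)ᶜ := by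
    rintro ω ⟨z, hz, hω⟩
    obtain ⟨w, hw, hzw⟩ := hcov z hz
    refine mem_biUnion hw (mem_iInter₂.2 fun i hi => ?_)
    have h1 := hω i (Finset.mem_range.1 hi)
    have h2 := dist_triangle (X i ω) w z
    rw [dist_comm w z] at h2
    simp only [mem_preimage, mem_compl_iff, Metric.mem_ball, not_lt]
    linarith
  have hone : ∀ w ∈ F, P.real (⋂ i ∈ Finset.range n, X i ⁻¹' (Metric.ball w r)ᶜ) ≤
      Real.exp (-(c * r ^ d * n)) := by
    intro w hw
    have hmeas : MeasurableSet (Metric.ball w r) := Metric.isOpen_ball.measurableSet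
    have h1 : ∀ i, P.real (X i ⁻¹' (Metric.ball w r)ᶜ) ≤ Real.exp (-(c * r ^ d)) := by
      intro i
      have h2 : P.real (X i ⁻¹' (Metric.ball w r)ᶜ) = 1 - μ.real (Metric.ball w r) := by
        rw [← hlaw i, preimage_compl, probReal_compl_eq_one_sub (hX i hmeas),
          map_measureReal_apply (hX i) hmeas]
      rw [h2]
      have h3 := hball w (hF hw) r hr hr₀
      linarith [Real.add_one_le_exp (-(c * r ^ d))]
    calc _ = ∏ i ∈ Finset.range n, P.real (X i ⁻¹' (Metric.ball w r)ᶜ) := by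
          simp only [measureReal_def]
          rw [hind.measure_inter_preimage_eq_mul _ (fun i _ => hmeas.compl), ENNReal.toReal_prod]
      _ ≤ ∏ _i ∈ Finset.range n, Real.exp (-(c * r ^ d)) :=
        Finset.prod_le_prod (fun _ _ => measureReal_nonneg) fun i _ => h1 i
      _ = _ := by
        rw [Finset.prod_const, Finset.card_range, ← Real.exp_nat_mul]
        congr 1
        ring
  have hle : P.real {ω | ∃ z ∈ S, ∀ i < n, 2 * r < dist (X i ω) z} ≤
      Real.exp (-(c * r ^ d * n)) / (c * (r / 2) ^ d) := by
    calc _ ≤ P.real (⋃ w ∈ F, ⋂ i ∈ Finset.range n, X i ⁻¹' (Metric.ball w r)ᶜ) :=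
          measureReal_mono hsub (measure_ne_top _ _)
      _ ≤ ∑ w ∈ F, P.real (⋂ i ∈ Finset.range n, X i ⁻¹' (Metric.ball w r)ᶜ) :=
        measureReal_biUnion_finset_le _ _
      _ ≤ ∑ _w ∈ F, Real.exp (-(c * r ^ d * n)) := Finset.sum_le_sum hone
      _ = F.card * Real.exp (-(c * r ^ d * n)) := by simp
      _ ≤ _ := by
        rw [le_div_iff₀ (by positivity)]
        nlinarith [Real.exp_pos (-(c * r ^ d * n))]
  rw [← ofReal_measureReal]
  exact ENNReal.ofReal_le_ofReal hle

/-- If balls of radius `r` have mass of order at least `r ^ d` and `n * ε n ^ d` is eventually much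
larger than `log n`, then almost surely the sample is eventually dense at any scale comparable
to `ε n`. -/
theorem ae_eventually_forall_exists_dist_le (hX : ∀ i, Measurable (X i)) (hind : iIndepFun X P)
    (hlaw : ∀ i, P.map (X i) = μ) (hc : 0 < c) (hr₀ : 0 < r₀)
    (hball : ∀ z ∈ S, ∀ r, 0 < r → r ≤ r₀ → c * r ^ d ≤ μ.real (Metric.ball z r)) {ε : ℕ → ℝ}
    (hε : ∀ n, 0 < ε n) (hεlim : Tendsto ε atTop (𝓝 0))
    (hrate : ∀ A : ℝ, 0 < A → ∀ᶠ n : ℕ in atTop, A * Real.log n ≤ n * ε n ^ d) {δ : ℝ}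
    (hδ : 0 < δ) :
    ∀ᵐ ω ∂P, ∀ᶠ n in atTop, ∀ z ∈ S, ∃ i < n, dist (X i ω) z ≤ δ * ε n := by
  have h1 : ∀ᶠ n in atTop, δ * ε n / 2 ≤ r₀ := by
    have : Tendsto (fun n => δ * ε n / 2) atTop (𝓝 0) := by
      simpa using (hεlim.const_mul δ).div_const 2
    exact (this.eventually_lt_const hr₀).mono fun n hn => hn.le
  -- With `r = δ * ε n / 2`, this constant gives `c * r ^ d * n ≥ 3 * log n`, so the exponential is
  -- at most `n ^ (-3)`. The cardinality of the net costs at most `2 ^ d * n`, because `log n ≥ 1`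
  -- for `n ≥ 3`; the bound `2 ^ d / n ^ 2` is summable.
  obtain ⟨N, hN⟩ := eventually_atTop.1
    (h1.and ((hrate (3 / (c * (δ / 2) ^ d)) (by positivity)).and (eventually_ge_atTop 3)))
  let s : ℕ → Set Ω := fun n =>
    if N ≤ n then {ω | ∃ z ∈ S, ∀ i < n, 2 * (δ * ε n / 2) < dist (X i ω) z} else ∅
  have hs : ∀ n, P (s n) ≤ ENNReal.ofReal (2 ^ d * ((n : ℝ) ^ 2)⁻¹) := by
    intro n
    by_cases hn : N ≤ n
    · obtain ⟨hn1, hn2, hn3⟩ := hN n hn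
      simp only [s, hn, if_true]
      have hr : 0 < δ * ε n / 2 := by have := hε n; positivity
      refine (measure_exists_empty_ball_le hX hind hlaw hc hball hr hn1 n).trans
        (ENNReal.ofReal_le_ofReal ?_)
      set r := δ * ε n / 2 with hrdef
      have hn0 : (0 : ℝ) < n := by exact_mod_cast (by omega : 0 < n)
      have hrd : c * r ^ d * n = c * (δ / 2) ^ d * (n * ε n ^ d) := by
        rw [hrdef, show δ * ε n / 2 = δ / 2 * ε n by ring, mul_pow]
        ring
      have hlog : 3 * Real.log n ≤ c * r ^ d * n := by
        rw [hrd]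
        rw [div_mul_eq_mul_div, div_le_iff₀ (by positivity)] at hn2
        linarith
      have hlog1 : 1 ≤ Real.log n := by
        rw [Real.le_log_iff_exp_le hn0]
        have : (3 : ℝ) ≤ n := by exact_mod_cast hn3
        linarith [Real.exp_one_lt_d9]
      have hexp : Real.exp (-(c * r ^ d * n)) ≤ ((n : ℝ) ^ 3)⁻¹ := by
        rw [Real.exp_neg]
        gcongr
        calc (n : ℝ) ^ 3 = Real.exp (3 * Real.log n) := by
              rw [← Real.exp_log (pow_pos hn0 3), Real.log_pow]
              norm_num
          _ ≤ _ := Real.exp_le_exp.2 hlog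
      rw [div_le_iff₀ (by positivity)]
      calc _ ≤ ((n : ℝ) ^ 3)⁻¹ * 1 := by rw [mul_one]; exact hexp
        _ ≤ ((n : ℝ) ^ 3)⁻¹ * (c * r ^ d * n) := by
          gcongr
          linarith
        _ = _ := by
          rw [div_pow r]
          field_simp
    · simp [s, hn]
  have hsum : ∑' n, P (s n) ≠ ⊤ := by
    refine ne_top_of_le_ne_top ?_ (ENNReal.tsum_le_tsum hs)
    refine Summable.tsum_ofReal_ne_top ?_
    exact (Real.summable_nat_pow_inv.2 (by norm_num)).mul_left _
  filter_upwards [ae_eventually_notMem hsum] with ω hω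
  filter_upwards [hω, eventually_ge_atTop N] with n hn hNn z hz
  simp only [s, hNn, if_true, mem_ofPred_eq, not_exists, not_and, not_forall, not_lt] at hn
  obtain ⟨i, hi, h⟩ := hn z hz
  exact ⟨i, hi, by linarith⟩

end Sample

/-! ### Convex bodies -/

lemma IsConvexBody.convex (hD : IsConvexBody D) : Convex ℝ D := by
  obtain ⟨U, -, -, -, h, rfl⟩ := hD
  exact h.closure

lemma IsConvexBody.isCompact (hD : IsConvexBody D) : IsCompact D := by
  obtain ⟨U, -, -, h, -, rfl⟩ := hD
  exact h.isCompact_closure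

lemma IsConvexBody.exists_ball_subset (hD : IsConvexBody D) :
    ∃ z R, 0 < R ∧ Metric.ball z R ⊆ D := by
  obtain ⟨U, ⟨z, hz⟩, hU, -, -, rfl⟩ := hD
  obtain ⟨R, hR, h⟩ := Metric.isOpen_iff.1 hU z hz
  exact ⟨z, R, hR, h.trans subset_closure⟩

lemma IsConvexBody.nontrivial (hD : IsConvexBody D) (hd : 1 ≤ d) : D.Nontrivial := by
  obtain ⟨z, R, hR, h⟩ := hD.exists_ball_subset
  have : Nonempty (Fin d) := ⟨⟨0, hd⟩⟩
  exact (infinite_of_mem_nhds z (Metric.ball_mem_nhds z hR)).nontrivial.mono h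

/-- The part of a convex body in a small ball centred in it has volume of the order of the volume
of the ball. -/
lemma IsConvexBody.exists_volume_ball_inter_ge (hD : IsConvexBody D) :
    ∃ κ > 0, ∃ r₀ > 0, ∀ z ∈ D, ∀ r, 0 < r → r ≤ r₀ →
      ENNReal.ofReal (κ * r ^ d) ≤ volume (Metric.ball z r ∩ D) := by
  obtain ⟨z₀, R, hR, hball⟩ := hD.exists_ball_subset
  obtain ⟨M, hM⟩ := hD.isCompact.isBounded.subset_closedBall z₀
  have hz₀ : z₀ ∈ D := hball (Metric.mem_ball_self hR)
  have hM0 : 0 ≤ M := by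
    have := hM hz₀
    simpa using this
  set V := volume.real (Metric.ball (0 : EuclideanSpace ℝ (Fin d)) 1) with hV
  have hVpos : 0 < V :=
    ENNReal.toReal_pos (Metric.measure_ball_pos _ _ one_pos).ne' measure_ball_lt_top.ne
  set r₀ := M + R + 1 with hr₀
  have hr₀pos : 0 < r₀ := by positivity
  refine ⟨(R / r₀) ^ d * V, by positivity, r₀, hr₀pos, fun z hz r hr hrr => ?_⟩
  have hs : 0 < r / r₀ := by positivity
  have hs1 : r / r₀ ≤ 1 := (div_le_one hr₀pos).2 hrr
  -- This ball is the image of `ball z₀ R` under the homothety with centre `z` and ratio `r / r₀ ≤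
  -- 1`. Convexity keeps it in `D`, and `r₀` exceeds the distance from `z` to any point of `ball z₀
  -- R`.
  have hsub : Metric.ball (z + (r / r₀) • (z₀ - z)) (r / r₀ * R) ⊆ Metric.ball z r ∩ D := by
    intro y hy
    obtain ⟨y', rfl⟩ : ∃ y', y = z + (r / r₀) • (y' - z) :=
      ⟨z + (r / r₀)⁻¹ • (y - z), by rw [add_sub_cancel_left, smul_inv_smul₀ hs.ne', add_sub_cancel]⟩
    have hy' : y' ∈ Metric.ball z₀ R := by
      rw [Metric.mem_ball, dist_eq_norm, show z + (r / r₀) • (y' - z) -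
        (z + (r / r₀) • (z₀ - z)) = (r / r₀) • (y' - z₀) by module, norm_smul,
        Real.norm_of_nonneg hs.le] at hy
      rw [Metric.mem_ball, dist_eq_norm]
      exact lt_of_mul_lt_mul_left hy hs.le
    refine ⟨?_, hD.convex.add_smul_sub_mem hz (hball hy') ⟨hs.le, hs1⟩⟩
    have h1 : ‖y' - z‖ < r₀ := by
      have h2 := norm_sub_le_norm_sub_add_norm_sub y' z₀ z
      have h3 : ‖z - z₀‖ ≤ M := by simpa [dist_eq_norm] using hM hz
      rw [Metric.mem_ball, dist_eq_norm] at hy'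
      rw [norm_sub_rev z₀] at h2
      linarith
    rw [Metric.mem_ball, dist_eq_norm, add_sub_cancel_left, norm_smul, Real.norm_of_nonneg hs.le]
    calc r / r₀ * ‖y' - z‖ < r / r₀ * r₀ := by gcongr
      _ = r := by field_simp
  refine le_trans (le_of_eq ?_) (measure_mono hsub)
  rw [Measure.addHaar_ball_of_pos _ _ (by positivity), finrank_euclideanSpace_fin,
    ← ofReal_measureReal (μ := volume) (s := Metric.ball (0 : EuclideanSpace ℝ (Fin d)) 1),
    ← ENNReal.ofReal_mul (by positivity)]
  congr 1
  rw [← hV, show r / r₀ * R = R / r₀ * r by ring, mul_pow]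
  ring

lemma IsConvexBody.exists_withDensity_ball_ge (hD : IsConvexBody D)
    {ρ : EuclideanSpace ℝ (Fin d) → ℝ} {c : ℝ} (hc : 0 < c) (hρ : ∀ x ∈ D, c ≤ ρ x)
    [IsProbabilityMeasure ((volume.restrict D).withDensity fun x => ENNReal.ofReal (ρ x))] :
    ∃ κ > 0, ∃ r₀ > 0, ∀ z ∈ D, ∀ r, 0 < r → r ≤ r₀ → κ * r ^ d ≤
      ((volume.restrict D).withDensity fun x => ENNReal.ofReal (ρ x)).real (Metric.ball z r) := by
  obtain ⟨κ, hκ, r₀, hr₀, h⟩ := hD.exists_volume_ball_inter_ge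
  refine ⟨c * κ, by positivity, r₀, hr₀, fun z hz r hr hrr => ?_⟩
  have hm : MeasurableSet (Metric.ball z r) := Metric.isOpen_ball.measurableSet
  refine (ENNReal.ofReal_le_iff_le_toReal (measure_ne_top _ _)).1 ?_
  rw [withDensity_apply _ hm]
  calc ENNReal.ofReal (c * κ * r ^ d) = ENNReal.ofReal c * ENNReal.ofReal (κ * r ^ d) := by
        rw [← ENNReal.ofReal_mul hc.le, mul_assoc]
    _ ≤ ENNReal.ofReal c * volume (Metric.ball z r ∩ D) := by gcongr; exact h z hz r hr hrr
    _ = ∫⁻ _x in Metric.ball z r, ENNReal.ofReal c ∂(volume.restrict D) := by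
      rw [setLIntegral_const, Measure.restrict_apply hm]
    _ ≤ _ := by
      refine lintegral_mono_ae (ae_restrict_of_ae ?_)
      filter_upwards [ae_restrict_mem hD.isCompact.isClosed.measurableSet] with x hx
      exact ENNReal.ofReal_le_ofReal (hρ x hx)

/-- The `d`-th power of the rate condition says that `log n / (n * ε n ^ d)` tends to `0`. -/
lemma eventually_mul_log_le_of_tendsto {ε : ℕ → ℝ} (hd : 1 ≤ d) (hε : ∀ n, 0 < ε n)
    (hrate : Tendsto (fun n : ℕ =>
      (Real.log n) ^ (1 / (d : ℝ)) / (n : ℝ) ^ (1 / (d : ℝ)) * (1 / ε n)) atTop (𝓝 0)) {A : ℝ}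
    (hA : 0 < A) : ∀ᶠ n : ℕ in atTop, A * Real.log n ≤ n * ε n ^ d := by
  have hd0 : d ≠ 0 := by omega
  have h := hrate.pow d
  rw [zero_pow hd0] at h
  filter_upwards [h.eventually_lt_const (inv_pos.2 hA), eventually_ge_atTop 1] with n hn hn1
  have hn0 : (0 : ℝ) < n := by exact_mod_cast hn1
  have hlog : 0 ≤ Real.log n := Real.log_natCast_nonneg n
  have hεn := hε n
  rw [mul_pow, div_pow, one_div (d : ℝ), Real.rpow_inv_natCast_pow hlog hd0,
    Real.rpow_inv_natCast_pow hn0.le hd0, div_pow, one_pow, div_mul_div_comm, mul_one,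
    div_lt_iff₀ (by positivity), inv_mul_eq_div, lt_div_iff₀ hA] at hn
  linarith

end RandomGeodesics

namespace RandomGeodesics

variable {d : ℕ} {D : Set (EuclideanSpace ℝ (Fin d))} {p : ℝ}
  {f : EuclideanSpace ℝ (Fin d) → EuclideanSpace ℝ (Fin d) → ℝ}
  {a b : EuclideanSpace ℝ (Fin d)}

/-! ### Convergence for a fixed realisation of the sample -/

lemma vertices_subset {x : ℕ → EuclideanSpace ℝ (Fin d)} (hx : ∀ i, x i ∈ D) (ha : a ∈ D)
    (hb : b ∈ D) (n : ℕ) : vertices x n a b ⊆ D := by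
  rintro _ (⟨i, -, rfl⟩ | rfl | rfl)
  exacts [hx i, ha, hb]

lemma isLeast_gdist_rpow (hf : IsKernel D p f) (hp : 1 < p) (hD : Convex ℝ D)
    (hDc : IsCompact D) (ha : a ∈ D) (hb : b ∈ D) :
    IsLeast (cost f '' lipPaths D a b) (gdist p f D a b ^ p) := by
  obtain ⟨γ₀, hγ₀, hcost, -⟩ := exists_geodesic hf hp hD hDc ha hb
  refine ⟨⟨γ₀, hγ₀, hcost⟩, ?_⟩
  rintro _ ⟨η, hη, rfl⟩
  exact gdist_rpow_le_cost hf (by linarith) hη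

/-- The minima are at least the continuous one because polylines are Lipschitz paths in `D`, and at
most slightly larger by the recovery polylines. -/
theorem exists_tendsto_isLeast_cost_polyPaths (hf : IsKernel D p f) (hp : 1 < p)
    (hD : Convex ℝ D) (hDc : IsCompact D) (hnt : D.Nontrivial) (ha : a ∈ D) (hb : b ∈ D)
    {x : ℕ → EuclideanSpace ℝ (Fin d)} (hx : ∀ i, x i ∈ D) {ε : ℕ → ℝ} (hε : ∀ n, 0 < ε n)
    (hεlim : Tendsto ε atTop (𝓝 0))
    (hdense : ∀ δ > 0, ∀ᶠ n in atTop, ∀ z ∈ D, ∃ i < n, ‖x i - z‖ ≤ δ * ε n) :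
    ∃ L : ℕ → ℝ, (∀ᶠ n in atTop, IsLeast (cost f '' polyPaths x n (ε n) a b) (L n)) ∧
      Tendsto L atTop (𝓝 (gdist p f D a b ^ p)) := by
  have hp0 : 0 < p := by linarith
  have hV := vertices_subset hx ha hb
  have hnear : ∀ κ > 0, ∀ᶠ n in atTop, ∃ γ ∈ polyPaths x n (ε n) a b,
      cost f γ ≤ gdist p f D a b ^ p + κ := by
    intro κ hκ
    obtain ⟨δ, hδ, e₀, he₀, h⟩ := exists_polyPath_cost_le hf hp hD hDc hnt ha hb hκ
    filter_upwards [hdense δ hδ, hεlim.eventually_lt_const he₀] with n hn hn'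
    exact h x n (ε n) (hε n) hn' (hV n) hn
  have hleast : ∀ᶠ n in atTop, ∃ L, IsLeast (cost f '' polyPaths x n (ε n) a b) L := by
    filter_upwards [hnear 1 one_pos] with n ⟨γ, hγ, _⟩
    exact exists_isLeast_cost_polyPaths hf hp0 hD (hV n) ⟨γ, hγ⟩
  obtain ⟨L, hL⟩ := hleast.choice
  refine ⟨L, hL, ?_⟩
  rw [Metric.tendsto_nhds]
  intro κ hκ
  filter_upwards [hL, hnear (κ / 2) (half_pos hκ)] with n hn ⟨γ, hγ, hle⟩
  obtain ⟨η, hη, hηL⟩ := hn.1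
  have h1 := hn.2 (mem_image_of_mem _ hγ)
  have h2 := gdist_rpow_le_cost hf hp0 (polyPaths_subset_lipPaths hD (hV n) hη)
  rw [Real.dist_eq, abs_lt]
  constructor <;> linarith

theorem exists_subseq_of_eventually_argmin (hf : IsKernel D p f) (hp : 1 < p)
    (hD : Convex ℝ D) (hDc : IsCompact D) {S : ℕ → Set (ℝ → EuclideanSpace ℝ (Fin d))}
    (hS : ∀ n, S n ⊆ lipPaths D a b) {L : ℕ → ℝ}
    (hL : ∀ᶠ n in atTop, IsLeast (cost f '' S n) (L n))
    (hlim : Tendsto L atTop (𝓝 (gdist p f D a b ^ p)))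
    {γ : ℕ → ℝ → EuclideanSpace ℝ (Fin d)} (hγ : ∀ᶠ n in atTop, γ n ∈ argmin (cost f) (S n))
    {φ : ℕ → ℕ} (hφ : StrictMono φ) :
    ∃ ψ : ℕ → ℕ, StrictMono ψ ∧ ∃ γ₀ ∈ argmin (cost f) (lipPaths D a b),
      TendstoUniformlyOn (fun k => γ (φ (ψ k))) γ₀ atTop (Icc 0 1) := by
  have hev : ∀ᶠ n in atTop, γ n ∈ lipPaths D a b ∧ cost f (γ n) = L n := by
    filter_upwards [hL, hγ] with n hn hn'
    obtain ⟨η, hη, hηL⟩ := hn.1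
    exact ⟨hS n hn'.1, le_antisymm ((hn'.2 η hη).trans_eq hηL)
      (hn.2 (mem_image_of_mem _ hn'.1))⟩
  obtain ⟨N, hN⟩ := eventually_atTop.1 (hφ.tendsto_atTop.eventually hev)
  -- Minimality holds only for large `n`; the shift discards the earlier terms, which need not be
  -- paths at all.
  have hshift : StrictMono fun k : ℕ => k + N := fun _ _ h => Nat.add_lt_add_right h N
  obtain ⟨ψ, hψ, γ₀, hγ₀, -, -, hunif⟩ := exists_subseq_tendstoUniformlyOn_argmin hf hp hD hDc
    (γ := fun k => γ (φ (k + N))) (fun k => (hN (k + N) (by omega)).1) (by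
      simp only [(hN (_ + N) (Nat.le_add_left N _)).2]
      exact hlim.comp (hφ.tendsto_atTop.comp hshift.tendsto_atTop))
  exact ⟨fun k => ψ k + N, hshift.comp hψ, γ₀, hγ₀, hunif⟩

lemma tendstoUniformlyOn_of_subseq {α β : Type*} [PseudoMetricSpace β] {F : ℕ → α → β} {g : α → β}
    {s : Set α} (h : ∀ φ : ℕ → ℕ, StrictMono φ →
      ∃ ψ : ℕ → ℕ, TendstoUniformlyOn (fun k => F (φ (ψ k))) g atTop s) :
    TendstoUniformlyOn F g atTop s := by
  rw [Metric.tendstoUniformlyOn_iff]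
  intro e he
  by_contra hcon
  obtain ⟨φ, hφ, hbad⟩ := extraction_of_frequently_atTop (not_eventually.1 hcon)
  obtain ⟨ψ, hψ⟩ := h φ hφ
  obtain ⟨k, hk⟩ := (Metric.tendstoUniformlyOn_iff.1 hψ e he).exists
  exact hbad (ψ k) hk

end RandomGeodesics

/-! ### The almost sure statement -/

theorem mainTheorem1
    {d : ℕ} (hd : 1 ≤ d)
    (D : Set (EuclideanSpace ℝ (Fin d))) (hD : RandomGeodesics.IsConvexBody D)
    (a b : EuclideanSpace ℝ (Fin d)) (ha : a ∈ D) (hb : b ∈ D)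
    (p : ℝ) (hp : 1 < p)
    (f : EuclideanSpace ℝ (Fin d) → EuclideanSpace ℝ (Fin d) → ℝ)
    (hf : RandomGeodesics.IsKernel D p f)
    -- the i.i.d. sample, with density bounded above and below on `D`
    {Ω : Type*} [MeasurableSpace Ω] (P : Measure Ω) [IsProbabilityMeasure P]
    (X : ℕ → Ω → EuclideanSpace ℝ (Fin d)) (hXmeas : ∀ i, Measurable (X i))
    (hXindep : iIndepFun X P)
    (ρ : EuclideanSpace ℝ (Fin d) → ℝ) (hρmeas : Measurable ρ)
    (hXlaw : ∀ i, P.map (X i) =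
      (volume.restrict D).withDensity (fun x => ENNReal.ofReal (ρ x)))
    (hρ : ∃ c : ℝ, 0 < c ∧ ∀ x ∈ D, c ≤ ρ x ∧ ρ x ≤ c⁻¹)
    -- the length scales
    (ε : ℕ → ℝ) (hεpos : ∀ n, 0 < ε n) (hεlim : Tendsto ε atTop (𝓝 0))
    (hεrate : Tendsto (fun n : ℕ =>
      (Real.log n) ^ (1 / (d : ℝ)) / (n : ℝ) ^ (1 / (d : ℝ)) * (1 / ε n)) atTop (𝓝 0)) :
    -- `F` has a minimum `μ` on `Ω(a,b)`, and almost surely: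
    ∃ μ : ℝ, IsLeast (RandomGeodesics.cost f '' RandomGeodesics.lipPaths D a b) μ ∧
    ∀ᵐ ω ∂P,
      -- for all large `n` the minimum of `Lₙ` exists, and these minima converge to `μ`
      (∃ L : ℕ → ℝ,
        (∀ᶠ n in atTop, IsLeast (RandomGeodesics.cost f ''
          RandomGeodesics.polyPaths (fun i => X i ω) n (ε n) a b) (L n)) ∧
        Tendsto L atTop (𝓝 μ)) ∧
      -- for any sequence of minimizers `γₙ` of `Lₙ` (for all large `n`):
      (∀ γ : ℕ → ℝ → EuclideanSpace ℝ (Fin d),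
        (∀ᶠ n in atTop, γ n ∈ RandomGeodesics.argmin (RandomGeodesics.cost f)
          (RandomGeodesics.polyPaths (fun i => X i ω) n (ε n) a b)) →
        -- each subsequence has a further subsequence converging uniformly to a minimizer of `F`
        (∀ φ : ℕ → ℕ, StrictMono φ →
          ∃ ψ : ℕ → ℕ, StrictMono ψ ∧
          ∃ γ₀ ∈ RandomGeodesics.argmin (RandomGeodesics.cost f)
              (RandomGeodesics.lipPaths D a b),
            TendstoUniformlyOn (fun k => γ (φ (ψ k))) γ₀ atTop (Icc 0 1)) ∧
        -- and if `F` has only one minimizer, the whole sequence converges uniformly to it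
        (∀ γ₀ ∈ RandomGeodesics.argmin (RandomGeodesics.cost f)
              (RandomGeodesics.lipPaths D a b),
          (∀ η ∈ RandomGeodesics.argmin (RandomGeodesics.cost f)
              (RandomGeodesics.lipPaths D a b), EqOn η γ₀ (Icc 0 1)) →
          TendstoUniformlyOn γ γ₀ atTop (Icc 0 1))) := by

  obtain ⟨c, hc, hρ⟩ := hρ
  have hDconv := hD.convex
  have hDc := hD.isCompact
  refine ⟨RandomGeodesics.gdist p f D a b ^ p,
    RandomGeodesics.isLeast_gdist_rpow hf hp hDconv hDc ha hb, ?_⟩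
  have : IsProbabilityMeasure
      ((volume.restrict D).withDensity fun x => ENNReal.ofReal (ρ x)) :=
    hXlaw 0 ▸ Measure.isProbabilityMeasure_map (hXmeas 0).aemeasurable
  obtain ⟨κ, hκ, r₀, hr₀, hball⟩ := hD.exists_withDensity_ball_ge hc fun x hx => (hρ x hx).1
  have hmem : ∀ᵐ ω ∂P, ∀ i, X i ω ∈ D := by
    refine ae_all_iff.2 fun i => ae_of_ae_map (hXmeas i).aemeasurable ?_
    rw [hXlaw i]
    exact (withDensity_absolutelyContinuous _ _).ae_le
      (ae_restrict_mem hDc.isClosed.measurableSet)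
  -- Countably many density constants `1 / (k + 1)` give a single null set that serves all `δ > 0`.
  have hdense : ∀ᵐ ω ∂P, ∀ k : ℕ, ∀ᶠ n in atTop, ∀ z ∈ D, ∃ i < n,
      dist (X i ω) z ≤ 1 / ((k : ℝ) + 1) * ε n :=
    ae_all_iff.2 fun k => RandomGeodesics.ae_eventually_forall_exists_dist_le hXmeas hXindep hXlaw
      hκ hr₀ hball hεpos hεlim
      (fun A hA => RandomGeodesics.eventually_mul_log_le_of_tendsto hd hεpos hεrate hA)
      (by positivity)
  filter_upwards [hmem, hdense] with ω hω hωd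
  obtain ⟨L, hL, hlim⟩ := RandomGeodesics.exists_tendsto_isLeast_cost_polyPaths hf hp hDconv hDc
    (hD.nontrivial hd) ha hb hω hεpos hεlim (fun δ hδ => by
      obtain ⟨k, hk⟩ := exists_nat_one_div_lt hδ
      filter_upwards [hωd k] with n hn z hz
      obtain ⟨i, hi, h⟩ := hn z hz
      refine ⟨i, hi, (dist_eq_norm (X i ω) z ▸ h).trans ?_⟩
      exact mul_le_mul_of_nonneg_right hk.le (hεpos n).le)
  refine ⟨⟨L, hL, hlim⟩, fun γ hγ => ?_⟩
  have hsub : ∀ φ : ℕ → ℕ, StrictMono φ → ∃ ψ : ℕ → ℕ, StrictMono ψ ∧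
      ∃ γ₀ ∈ RandomGeodesics.argmin (RandomGeodesics.cost f) (RandomGeodesics.lipPaths D a b),
        TendstoUniformlyOn (fun k => γ (φ (ψ k))) γ₀ atTop (Icc 0 1) := fun φ hφ =>
    RandomGeodesics.exists_subseq_of_eventually_argmin hf hp hDconv hDc
      (fun n => RandomGeodesics.polyPaths_subset_lipPaths hDconv
        (RandomGeodesics.vertices_subset hω ha hb n)) hL hlim hγ hφ
  refine ⟨hsub, fun γ₀ hγ₀ huniq => RandomGeodesics.tendstoUniformlyOn_of_subseq fun φ hφ => ?_⟩
  obtain ⟨ψ, -, η, hη, hunif⟩ := hsub φ hφ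
  exact ⟨ψ, hunif.congr_right (huniq η hη)⟩
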